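/- Let $n\ge 1$. **Kernels and operators.** For $t>0$, $x\in\mathbb R^n$ put $\Phi(t,x)=(4\pi t)^{-n/2}e^{-|x|^2/4t}$ and $\mathcal T_{ij}(t,x)=(2\pi)^{-n}\int_{\mathbb R^n}e^{ix\cdot\xi-t|\xi|^2}\big(\delta_{ij}-\tfrac{\xi_i\xi_j}{|\xi|^2}\big)\,d\xi$. For $f:\mathbb R^n\to\mathbb R^n$ and $u,v:(0,T)\times\mathbb R^n\to\mathbb R^n$ put $$S_i[f](t,x)=\int_{\mathbb R^n}\Phi(t,x-y)f_i(y)\,dy,\qquad B_i[u,v](t,x)=\int_0^t\!\int_{\mathbb R^n}\sum_{j,k}\partial_{x_k}\mathcal T_{ij}(t-s,x-y)\,u_j(s,y)v_k(s,y)\,dy\,ds .$$ **Lorentz spaces.** For a measurable $g$ let $\lambda_g(y)=|\{|g|>y\}|$, $g^*(t)=\sup\{y\in(0,\infty):\lambda_g(y)>t\}$, and let $\|g\|^*_{L^{p,q}}=\big(\tfrac qp\int_0^\infty[t^{1/p}g^*(t)]^q\tfrac{dt}{t}\big)^{1/q}$ for $p,q\in[1,\infty)$ and $\|g\|^*_{L^{p,\infty}}=\sup_{t>0}t^{1/p}g^*(t)$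 for $p\in[1,\infty]$. An additional exponent $\overline\infty$ is used, with $\|g\|^*_{L^{\overline\infty,\infty}}=\sup_x|g(x)|$ (supremum over every point); $1/r=0$ for $r\in\{\infty,\overline\infty\}$, and $(n,\overline\infty]=(n,\infty]\cup\{\overline\infty\}$. Write $g=_r h$ for equality almost everywhere on $\mathbb R^n$ if $r\le\infty$, and for equality everywhere if $r=\overline\infty$. $L^{p,q}(\mathbb R^n)$ consists of the measurable $g$ with $\|g\|^*_{L^{p,q}}<\infty$. **Path spaces.** For $T'\in(0,\infty)$ and measurable $u$ on $(0,T')\times\mathbb R^n$: $u\in\mathcal L^{\alpha,\beta}_{r,\infty}(T')$ if the function $t\mapsto\mathbf 1_{(0,T')}(t)\|u(t)\|^*_{L^{r,\infty}(\mathbb R^n)}$ has finite $L^{\alpha,\beta}(\mathbb R)$ quasinorm; $u\in\mathcal K^\sigma_{r,\infty}(T')$ if $\operatorname{ess\,sup}_{0<t<T'}t^{-\sigma/2}\|u(t)\|^*_{L^{r,\infty}}<\infty$; $u\in\mathcal J^\sigma_{r,\infty}(T')$ if $\sup_{0<t<T'}t^{-\sigma/2}\|u(t)\|^*_{L^{r,\infty}}<\infty$.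 For $T\in(0,\infty]$, $X(T_-)=\bigcap_{T'\in(0,T)}X(T')$ for each of these spaces $X$. Write $u=_r^{\mathrm{a.e.}}v$ if $u(t)=_rv(t)$ for almost every $t\in(0,T)$, and $u=_r^{\mathrm{e.}}v$ if $u(t)=_rv(t)$ for every $t\in(0,T)$. **Corollary.** Let $p\in(1,\infty]$, $r\in(n,\overline\infty]$, $\sigma\in\mathbb R$ with $-\sigma+\frac nr<1$, $T\in(0,\infty]$ and $f\in L^{p,\infty}(\mathbb R^n)$. (i) For any $\alpha\in(2,\infty)$ with $-\sigma+\frac nr<\frac2\alpha+\frac nr\le1$ and any $\beta\in[1,\infty)$: if $u\in\mathcal K^\sigma_{r,\infty}(T_-)$ and $v\in\mathcal L^{\alpha,\beta}_{r,\infty}(T_-)$ satisfy $S[f]=_r^{\mathrm{a.e.}}u+B[u,u]$ and $S[f]=_r^{\mathrm{a.e.}}v+B[v,v]$, then $u=_r^{\mathrm{a.e.}}v$. (ii) If $u,v\in\mathcal J^\sigma_{r,\infty}(T_-)$ satisfy $S[f]=_r^{\mathrm{e.}}u+B[u,u]$ and $S[f]=_r^{\mathrm{e.}}v+B[v,v]$,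 then $u=_r^{\mathrm{e.}}v$. -/

import Mathlib

open MeasureTheory Set
open scoped ENNReal NNReal

noncomputable section

namespace NSLorentz

/-! ### Lorentz quasinorms -/

/-- The distribution function `λ_g(y) = |{x : g(x) > y}|` of a nonnegative function `g`
(for a vector valued `f`, use `g = |f|`). -/
def distribution {X : Type*} [MeasurableSpace X] (μ : Measure X) (g : X → ℝ≥0∞) (y : ℝ≥0∞) :
    ℝ≥0∞ :=
  μ {x | y < g x}

/-- The decreasing rearrangement `g^*(t) = sup {y ∈ (0,∞) : λ_g(y) > t}` (with `sup ∅ = 0`). -/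
def rearrangement {X : Type*} [MeasurableSpace X] (μ : Measure X) (g : X → ℝ≥0∞) (t : ℝ≥0∞) :
    ℝ≥0∞ :=
  sSup {y | 0 < y ∧ y < ∞ ∧ t < distribution μ g y}

/-- The Lorentz quasinorm `‖g‖*_{L^{p,q}}` of a nonnegative function, namely
`sup_{t ∈ (0,∞)} t^{1/p} g^*(t)` for `p ∈ [1,∞]`, `q = ∞`, and
`((q/p) ∫_0^∞ [t^{1/p} g^*(t)]^q dt/t)^{1/q}` for `p, q ∈ [1,∞)`.
(The remaining combinations of `p` and `q` are never used.) -/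
def lorentz {X : Type*} [MeasurableSpace X] (μ : Measure X) (p q : ℝ≥0∞) (g : X → ℝ≥0∞) : ℝ≥0∞ :=
  if q = ∞ then
    ⨆ t ∈ Ioi (0 : ℝ),
      ENNReal.ofReal t ^ (p⁻¹).toReal * rearrangement μ g (ENNReal.ofReal t)
  else
    (q / p * ∫⁻ t in Ioi (0 : ℝ),
      (ENNReal.ofReal t ^ (p⁻¹).toReal * rearrangement μ g (ENNReal.ofReal t)) ^ q.toReal
        / ENNReal.ofReal t) ^ (q.toReal)⁻¹

/-- Exponents in `[1,∞] ∪ {∞bar}`: `std p` is an ordinary exponent `p`, and `bar` is the exponent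
`∞bar`, for which suprema and equalities are taken over every point, instead of up to null sets. -/
inductive Exponent where
  | std (p : ℝ≥0∞)
  | bar

/-- The size of an exponent: `∞bar` has the same size as `∞`. -/
def Exponent.toENNReal : Exponent → ℝ≥0∞
  | .std p => p
  | .bar => ∞

/-- The reciprocal `1/r`, with `1/r = 0` for `r ∈ {∞, ∞bar}`. -/
def Exponent.recip (r : Exponent) : ℝ := (r.toENNReal⁻¹).toReal

/-- `ℝⁿ` with its Euclidean norm and Lebesgue measure. -/
abbrev Rn (n : ℕ) : Type := EuclideanSpace ℝ (Fin n)

/-- The quasinorm `‖f‖*_{L^{p,q}(ℝⁿ)}` of a vector field; for `p = ∞bar` (where always `q = ∞`)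
it is the supremum of `|f|` over all points. -/
def lorentzNorm {n : ℕ} (p : Exponent) (q : ℝ≥0∞) (f : Rn n → Rn n) : ℝ≥0∞ :=
  match p with
  | .std p => lorentz volume p q (fun x => ‖f x‖ₑ)
  | .bar => ⨆ x, ‖f x‖ₑ

/-- `f ∈ L^{p,q}(ℝⁿ)`, for (Lebesgue) measurable `f`. -/
def MemLorentz {n : ℕ} (p : Exponent) (q : ℝ≥0∞) (f : Rn n → Rn n) : Prop :=
  AEMeasurable f volume ∧ lorentzNorm p q f < ∞

/-- The relation `f =_p g`: equality almost everywhere if `p ∈ [1,∞]`, everywhere if `p = ∞bar`. -/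
def EqSpace {n : ℕ} (p : Exponent) (f g : Rn n → Rn n) : Prop :=
  match p with
  | .std _ => ∀ᵐ x ∂(volume : Measure (Rn n)), f x = g x
  | .bar => ∀ x, f x = g x

/-! ### Path spaces on `(0,T)`, where `T ∈ (0,∞]` -/

/-- The time interval `(0,T)`. -/
def timeInterval (T : EReal) : Set ℝ := {t | 0 < t ∧ (t : EReal) < T}

/-- `u` is a (Lebesgue) measurable function on `(0,T) × ℝⁿ`. -/
def MeasurablePath {n : ℕ} (T : EReal) (u : ℝ → Rn n → Rn n) : Prop :=
  AEMeasurable (Function.uncurry u)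
    ((volume : Measure (ℝ × Rn n)).restrict (timeInterval T ×ˢ univ))

/-- `u ∈ 𝓛^{α,β}_{p,q}(T)`: the `L^{α,β}(ℝ)` quasinorm of
`t ↦ 1_{(0,T)}(t) ‖u(t)‖*_{L^{p,q}}` is finite. -/
def MemL {n : ℕ} (p : Exponent) (q α β : ℝ≥0∞) (T : EReal) (u : ℝ → Rn n → Rn n) : Prop :=
  MeasurablePath T u ∧
    lorentz (volume : Measure ℝ) α β
      ((timeInterval T).indicator fun t => lorentzNorm p q (u t)) < ∞

/-- `u ∈ 𝓚^σ_{p,q}(T)`: the essential supremum of `t^{-σ/2} ‖u(t)‖*_{L^{p,q}}` over `(0,T)` is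
finite. -/
def MemK {n : ℕ} (p : Exponent) (q : ℝ≥0∞) (σ : ℝ) (T : EReal) (u : ℝ → Rn n → Rn n) : Prop :=
  MeasurablePath T u ∧
    essSup (fun t => ENNReal.ofReal t ^ (-σ / 2) * lorentzNorm p q (u t))
      ((volume : Measure ℝ).restrict (timeInterval T)) < ∞

/-- `u ∈ 𝓙^σ_{p,q}(T)`: the supremum of `t^{-σ/2} ‖u(t)‖*_{L^{p,q}}` over `(0,T)` is finite. -/
def MemJ {n : ℕ} (p : Exponent) (q : ℝ≥0∞) (σ : ℝ) (T : EReal) (u : ℝ → Rn n → Rn n) : Prop :=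
  MeasurablePath T u ∧
    (⨆ t ∈ timeInterval T, ENNReal.ofReal t ^ (-σ / 2) * lorentzNorm p q (u t)) < ∞

/-- `u ∈ 𝓛^{α,β}_{p,q}(T₋) = ⋂_{T' ∈ (0,T)} 𝓛^{α,β}_{p,q}(T')`. -/
def MemLMinus {n : ℕ} (p : Exponent) (q α β : ℝ≥0∞) (T : EReal) (u : ℝ → Rn n → Rn n) : Prop :=
  ∀ T' ∈ timeInterval T, MemL p q α β (T' : EReal) u

/-- `u ∈ 𝓚^σ_{p,q}(T₋) = ⋂_{T' ∈ (0,T)} 𝓚^σ_{p,q}(T')`. -/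
def MemKMinus {n : ℕ} (p : Exponent) (q : ℝ≥0∞) (σ : ℝ) (T : EReal) (u : ℝ → Rn n → Rn n) :
    Prop :=
  ∀ T' ∈ timeInterval T, MemK p q σ (T' : EReal) u

/-- `u ∈ 𝓙^σ_{p,q}(T₋) = ⋂_{T' ∈ (0,T)} 𝓙^σ_{p,q}(T')`. -/
def MemJMinus {n : ℕ} (p : Exponent) (q : ℝ≥0∞) (σ : ℝ) (T : EReal) (u : ℝ → Rn n → Rn n) :
    Prop :=
  ∀ T' ∈ timeInterval T, MemJ p q σ (T' : EReal) u

/-- `u =_p^{a.e.} v`: `u(t) =_p v(t)` for almost every `t ∈ (0,T)`. -/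
def EqAE {n : ℕ} (p : Exponent) (T : EReal) (u v : ℝ → Rn n → Rn n) : Prop :=
  ∀ᵐ t ∂((volume : Measure ℝ).restrict (timeInterval T)), EqSpace p (u t) (v t)

/-- `u =_p^{e.} v`: `u(t) =_p v(t)` for all `t ∈ (0,T)`. -/
def EqE {n : ℕ} (p : Exponent) (T : EReal) (u v : ℝ → Rn n → Rn n) : Prop :=
  ∀ t ∈ timeInterval T, EqSpace p (u t) (v t)

/-! ### The kernels and the integral operators -/

/-- The heat kernel `Φ(t,x) = (4πt)^{-n/2} e^{-|x|²/4t}`. -/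
def heatKernel {n : ℕ} (t : ℝ) (x : Rn n) : ℝ :=
  1 / (4 * Real.pi * t) ^ ((n : ℝ) / 2) * Real.exp (-‖x‖ ^ 2 / (4 * t))

/-- The Fourier integral
`(2π)^{-n} ∫ e^{i x·ξ - t|ξ|²} (δ_{ij} - ξ_i ξ_j / |ξ|²) dξ`, as a complex number. -/
def oseenIntegral {n : ℕ} (i j : Fin n) (t : ℝ) (x : Rn n) : ℂ :=
  1 / (2 * (Real.pi : ℂ)) ^ n *
    ∫ ξ : Rn n, Complex.exp (Complex.I * (inner ℝ x ξ : ℝ) - (t * ‖ξ‖ ^ 2 : ℝ)) *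
      (((if i = j then 1 else 0) - ξ i * ξ j / ‖ξ‖ ^ 2 : ℝ) : ℂ)

/-- The Oseen kernel `𝒯_{ij}(t,x)`. The Fourier integral defining it is a real number
(see `oseenKernel_eq`), so taking the real part only changes the codomain. -/
def oseenKernel {n : ℕ} (i j : Fin n) (t : ℝ) (x : Rn n) : ℝ := (oseenIntegral i j t x).re

theorem oseenKernel_eq {n : ℕ} (i j : Fin n) (t : ℝ) (x : Rn n) :
    (oseenKernel i j t x : ℂ) = oseenIntegral i j t x := by
  unfold oseenKernel
  rw [← Complex.conj_eq_iff_re]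
  unfold oseenIntegral
  rw [map_mul, ← integral_conj, ← integral_neg_eq_self]
  congr 1
  · simp [Complex.conj_ofNat]
  · congr 1
    ext ξ
    simp [← Complex.exp_conj]

/-- The spatial derivative `∇_k 𝒯_{ij}(t,x)`. -/
def gradOseen {n : ℕ} (k i j : Fin n) (t : ℝ) (x : Rn n) : ℝ :=
  fderiv ℝ (oseenKernel i j t) x (EuclideanSpace.single k 1)

/-- `S_i[f](t,x) = ∫ Φ(t,x-y) f_i(y) dy`. -/
def heatMap {n : ℕ} (f : Rn n → Rn n) (t : ℝ) (x : Rn n) : Rn n :=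
  WithLp.toLp 2 fun i => ∫ y : Rn n, heatKernel t (x - y) * f y i

/-- `A_i[w](t,x) = ∫_0^t ∫ ∇_k 𝒯_{ij}(t-s,x-y) w_{jk}(s,y) dy ds`, summed over `j` and `k`.
(As for every Bochner integral, the value is a default one where the integral does not converge
absolutely; an equation at such a point is then less restrictive than one which asks for
convergence as well, never more.) -/
def opA {n : ℕ} (w : ℝ → Rn n → Matrix (Fin n) (Fin n) ℝ) (t : ℝ) (x : Rn n) : Rn n :=
  WithLp.toLp 2 fun i => ∫ s in Ioo 0 t, ∫ y : Rn n,
    ∑ j, ∑ k, gradOseen k i j (t - s) (x - y) * w s y j k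

/-- `B[u,v] = A[u ⊗ v]`. -/
def opB {n : ℕ} (u v : ℝ → Rn n → Rn n) : ℝ → Rn n → Rn n :=
  opA fun s y => Matrix.of fun j k => u s y j * v s y k

end NSLorentz

end

open MeasureTheory Set
open scoped ENNReal NNReal

noncomputable section

namespace NSLorentz

/-! ### Weak-type bounds -/

section

/-! Write θ = 1/r and measure space slices by the weak quasinorm sup_y y |{|g| > y}|^θ, which both
the Lorentz norm and, for the exponent ∞bar, the pointwise supremum dominate. By scaling, the
gradient of the Oseen kernel at time t has L¹ norm at most C t^{-1/2} and supremum at most C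
t^{-(n+1)/2} (`exists_gradOseenRep_bounds`). Interpolating between these bounds and using weak
Hölder for the product gives ‖B[u,v](t)‖ ≤ C ∫_0^t (t-s)^{-a} ‖u(s)‖ ‖v(s)‖ ds with a = 1/2 + nθ/2
(`exists_weakBound_duhamelAbs`). This needs θ < 1/2, which r > n gives when n ≥ 2; when n = 1 the
kernel vanishes and so does B.

Subtracting the two equations removes S[f], so H(t) = ‖u(t) - v(t)‖ satisfies H(t) ≤ C ∫_0^t
(t-s)^{-a} (‖u(s)‖ + ‖v(s)‖) H(s) ds. If the coefficient lies in weak L^{1/β} in time and a ≤ 1-β,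
weak Hölder followed by one-dimensional Hardy–Littlewood–Sobolev
(`exists_setLIntegral_timeKernel_le`) bounds the right side in weak L^{1/β} by the weak norm of the
coefficient times that of H. At a = 1-β, shortening the interval gains nothing from the kernel. The
smallness comes instead from the coefficient, through y λ(y)^β → 0 as y → ∞: this makes its weak
norm uniformly small on all sets of small measure, and H = 0 follows on successive intervals of a
fixed length (`ae_eq_zero_of_le_volterra`). Power weights t^{-b} with b < β have this decay
(`weakVanishing_rpow`), and so do functions in L^{α,q} with q < ∞ and β = 1/α
(`weakVanishing_of_lorentz_lt_top`).

Thus u = v almost everywhere. Then B[u,u] and B[v,v] agree at every point (`opB_eq_opB_of_eqAE`),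
and the equations themselves return equality in the sense that r requires.

Weak quasinorms do not pass under integral signs, so the estimates are carried out in the form ∫_E g
≤ N |E|^{1-θ}, which does. `WeakBound.setLIntegral_le` and `weakBound_of_setLIntegral_le` translate
between the two forms. -/

/-- The power `l ^ θ`, with value `0` at `l = 0` even for `θ = 0`. -/
def posRpow (θ : ℝ) (l : ℝ≥0∞) : ℝ≥0∞ := if l = 0 then 0 else l ^ θ

theorem posRpow_mono {θ : ℝ} (hθ : 0 ≤ θ) : Monotone (posRpow θ) := by
  intro a b hab
  unfold posRpow
  split_ifs with ha hb hb
  · exact le_rfl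
  · exact zero_le
  · exact absurd (le_antisymm (hb ▸ hab) zero_le) ha
  · exact ENNReal.rpow_le_rpow hab hθ

/-- `sup_y y λ_g(y)^θ ≤ M`; for `θ = 0` this says that `g ≤ M` almost everywhere. -/
def WeakBound {X : Type*} [MeasurableSpace X] (μ : Measure X) (θ : ℝ) (g : X → ℝ≥0∞)
    (M : ℝ≥0∞) : Prop :=
  ∀ y : ℝ≥0∞, y * posRpow θ (μ {x | y < g x}) ≤ M

variable {X : Type*} [MeasurableSpace X] {μ : Measure X} {θ : ℝ} {g : X → ℝ≥0∞} {M : ℝ≥0∞}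

theorem WeakBound.mono_bound (h : WeakBound μ θ g M) {M' : ℝ≥0∞} (hM : M ≤ M') :
    WeakBound μ θ g M' := fun y => (h y).trans hM

theorem volume_ofReal_lt (a : ℝ≥0∞) :
    (volume.restrict (Ioi (0 : ℝ))) {y : ℝ | ENNReal.ofReal y < a} = a := by
  have hm : MeasurableSet {y : ℝ | ENNReal.ofReal y < a} :=
    measurableSet_lt ENNReal.measurable_ofReal measurable_const
  rw [Measure.restrict_apply hm]
  induction a with
  | top => simp
  | coe a =>
    have : {y : ℝ | ENNReal.ofReal y < (a : ℝ≥0∞)} ∩ Ioi 0 = Ioo 0 (a : ℝ) := by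
      ext y
      simp only [mem_inter_iff, mem_ofPred_eq, mem_Ioi, mem_Ioo]
      constructor
      · rintro ⟨h1, h2⟩
        refine ⟨h2, ?_⟩
        rw [← ENNReal.ofReal_coe_nnreal] at h1
        exact (ENNReal.ofReal_lt_ofReal_iff_of_nonneg h2.le).1 h1
      · rintro ⟨h1, h2⟩
        refine ⟨?_, h1⟩
        rw [← ENNReal.ofReal_coe_nnreal]
        exact (ENNReal.ofReal_lt_ofReal_iff_of_nonneg h1.le).2 h2
    rw [this, Real.volume_Ioo]
    simp

/-- Both sides are the measure of the region under the graph of `g` in the product with the half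
line, sliced in the two possible orders. -/
theorem lintegral_eq_lintegral_measure_lt [SFinite μ] (hg : Measurable g) :
    ∫⁻ x, g x ∂μ = ∫⁻ y in Ioi (0 : ℝ), μ {x | ENNReal.ofReal y < g x} := by
  have hm : MeasurableSet {p : X × ℝ | ENNReal.ofReal p.2 < g p.1} :=
    measurableSet_lt (ENNReal.measurable_ofReal.comp measurable_snd) (hg.comp measurable_fst)
  have h1 := Measure.prod_apply (μ := μ) (ν := volume.restrict (Ioi (0 : ℝ))) hm
  have h2 := Measure.prod_apply_symm (μ := μ) (ν := volume.restrict (Ioi (0 : ℝ))) hm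
  refine Eq.trans ?_ (h1.symm.trans h2)
  refine lintegral_congr fun x => ?_
  exact (volume_ofReal_lt (g x)).symm

theorem lintegral_rpow_neg {κ R : ℝ} (hκ : κ < 1) (hR : 0 ≤ R) :
    ∫⁻ y in Ioo 0 R, ENNReal.ofReal y ^ (-κ) = ENNReal.ofReal (R ^ (1 - κ) / (1 - κ)) := by
  have hint : IntervalIntegrable (fun y : ℝ => y ^ (-κ)) volume 0 R :=
    intervalIntegral.intervalIntegrable_rpow' (by linarith)
  have h2 : ∫ y in (0 : ℝ)..R, y ^ (-κ) = R ^ (1 - κ) / (1 - κ) := by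
    rw [integral_rpow (Or.inl (by linarith)), Real.zero_rpow (by linarith), sub_zero,
      show -κ + 1 = 1 - κ by ring]
  rw [intervalIntegral.integral_of_le hR, integral_Ioc_eq_integral_Ioo] at h2
  rw [← h2, ofReal_integral_eq_lintegral_ofReal]
  · refine setLIntegral_congr_fun measurableSet_Ioo fun y hy => ?_
    exact ENNReal.ofReal_rpow_of_pos hy.1
  · exact ((intervalIntegrable_iff_integrableOn_Ioo_of_le hR).1 hint)
  · filter_upwards [ae_restrict_mem measurableSet_Ioo] with y hy
    exact Real.rpow_nonneg hy.1.le _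

/-- The integral of a bounded function with polynomially decaying distribution. -/
theorem lintegral_le_of_measure_lt_le {ν : Measure X} [SFinite ν] {K : X → ℝ≥0∞}
    (hK : Measurable K) {R κ : ℝ} (hR : 0 ≤ R) (hκ : κ < 1) (hKR : ∀ x, K x ≤ ENNReal.ofReal R)
    {D : ℝ≥0∞} (hD : ∀ y : ℝ, 0 < y → ν {x | ENNReal.ofReal y < K x} ≤ D * ENNReal.ofReal y ^ (-κ)) :
    ∫⁻ x, K x ∂ν ≤ D * ENNReal.ofReal (R ^ (1 - κ) / (1 - κ)) := by
  rw [lintegral_eq_lintegral_measure_lt hK, ← lintegral_rpow_neg hκ hR]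
  rw [← lintegral_const_mul _ (by fun_prop)]
  calc ∫⁻ y in Ioi (0 : ℝ), ν {x | ENNReal.ofReal y < K x}
      ≤ ∫⁻ y in Ioi (0 : ℝ), (Ioo 0 R).indicator (fun y => D * ENNReal.ofReal y ^ (-κ)) y := by
        refine setLIntegral_mono' measurableSet_Ioi fun y hy => ?_
        by_cases hyR : y < R
        · rw [indicator_of_mem (show y ∈ Ioo 0 R from ⟨hy, hyR⟩)]
          exact hD y hy
        · have : {x | ENNReal.ofReal y < K x} = ∅ := by
            ext x
            simp only [mem_ofPred_eq, mem_empty_iff_false, iff_false, not_lt]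
            exact (hKR x).trans (ENNReal.ofReal_le_ofReal (not_lt.1 hyR))
          simp [this]
    _ ≤ ∫⁻ y, (Ioo 0 R).indicator (fun y => D * ENNReal.ofReal y ^ (-κ)) y :=
        setLIntegral_le_lintegral _ _
    _ = _ := lintegral_indicator measurableSet_Ioo _

/-- A function with a weak-type bound of exponent `η < 1` is integrable on sets of finite
measure. -/
theorem WeakBound.setLIntegral_le [SFinite μ] {η : ℝ} (hη0 : 0 ≤ η) (hη : η < 1)
    (hg : Measurable g) (h : WeakBound μ η g M) {E : Set X} (hE : μ E ≠ ∞) :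
    ∫⁻ x in E, g x ∂μ ≤ ENNReal.ofReal (1 - η)⁻¹ * M * μ E ^ (1 - η) := by
  set l : ℝ → ℝ≥0∞ := fun y => (μ.restrict E) {x | ENNReal.ofReal y < g x} with hl
  have hanti : Antitone l := fun a b hab => measure_mono fun x hx =>
    lt_of_le_of_lt (ENNReal.ofReal_le_ofReal hab) hx
  have hlE : ∀ y, l y ≤ ENNReal.ofReal (μ E).toReal := fun y => by
    rw [ENNReal.ofReal_toReal hE]
    exact (measure_mono (subset_univ _)).trans (by simp)
  rw [lintegral_eq_lintegral_measure_lt hg]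
  -- A second layer cake, applied to the distribution function `l` itself: it is bounded by μ E, and
  -- the weak bound puts {l > z} inside {y ≤ M z^{-η}}.
  have := lintegral_le_of_measure_lt_le (ν := volume.restrict (Ioi (0 : ℝ))) (K := l)
    hanti.measurable ENNReal.toReal_nonneg hη hlE (D := M) ?_
  · refine this.trans_eq ?_
    rw [div_eq_inv_mul, ENNReal.ofReal_mul (by simp; linarith),
      ← ENNReal.ofReal_rpow_of_nonneg ENNReal.toReal_nonneg (by linarith),
      ENNReal.ofReal_toReal hE]
    ring
  · intro z hz
    have hz0 : ENNReal.ofReal z ≠ 0 := by simpa using hz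
    refine le_trans (measure_mono_ae (t := {y : ℝ | ENNReal.ofReal y ≤ M * ENNReal.ofReal z ^ (-η)})
      (Filter.Eventually.of_forall fun y hy => ?_)) ?_
    · have hy' : ENNReal.ofReal z < l y := hy
      have h1 := h (ENNReal.ofReal y)
      have h2 : ENNReal.ofReal z < μ {x | ENNReal.ofReal y < g x} :=
        hy'.trans_le (Measure.restrict_apply_le _ _)
      have h3 : ENNReal.ofReal y * ENNReal.ofReal z ^ η ≤ M := by
        refine le_trans ?_ h1
        rw [posRpow, if_neg (zero_le.trans_lt h2).ne']
        gcongr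
      show ENNReal.ofReal y ≤ M * ENNReal.ofReal z ^ (-η)
      rw [ENNReal.rpow_neg, ← div_eq_mul_inv,
        ENNReal.le_div_iff_mul_le (Or.inl (by simp [hz0])) (Or.inl (by simp [hz0]))]
      exact h3
    · generalize M * ENNReal.ofReal z ^ (-η) = B
      induction B with
      | top => exact le_top
      | coe b =>
        rw [Measure.restrict_apply (measurableSet_le ENNReal.measurable_ofReal measurable_const)]
        refine (measure_mono (t := Icc (0 : ℝ) b) ?_).trans (by simp)
        rintro y ⟨h1, h2⟩
        refine ⟨le_of_lt h2, ?_⟩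
        have h1 : ENNReal.ofReal y ≤ (b : ℝ≥0∞) := h1
        rw [← ENNReal.ofReal_coe_nnreal] at h1
        exact (ENNReal.ofReal_le_ofReal_iff b.2).1 h1

/-- The superlevel set of g² at y is that of g at √y. With Cauchy–Schwarz this is all that weak
Hölder needs. -/
theorem WeakBound.sq (h : WeakBound μ θ g M) : WeakBound μ (2 * θ) (fun x => g x ^ 2) (M ^ 2) := by
  intro y
  have hset : {x | y < g x ^ 2} = {x | y ^ (2⁻¹ : ℝ) < g x} := by
    ext x
    simp only [mem_ofPred_eq]
    rw [ENNReal.rpow_inv_lt_iff (by norm_num)]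
    norm_num
  have h1 := h (y ^ (2⁻¹ : ℝ))
  rw [hset]
  have h2 : y * posRpow (2 * θ) (μ {x | y ^ (2⁻¹ : ℝ) < g x}) =
      (y ^ (2⁻¹ : ℝ) * posRpow θ (μ {x | y ^ (2⁻¹ : ℝ) < g x})) ^ 2 := by
    rw [mul_pow, ← ENNReal.rpow_natCast, ← ENNReal.rpow_mul]
    norm_num
    unfold posRpow
    split_ifs
    · simp
    · rw [← ENNReal.rpow_natCast, ← ENNReal.rpow_mul, mul_comm 2 θ]
      simp
  rw [h2]
  gcongr

/-- The weak Hölder inequality, on a set of finite measure. -/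
theorem WeakBound.setLIntegral_mul_le [SFinite μ] (hθ0 : 0 ≤ θ) (hθ : θ < 1 / 2)
    {g' : X → ℝ≥0∞} {M' : ℝ≥0∞} (hg : Measurable g) (hg' : Measurable g')
    (h : WeakBound μ θ g M) (h' : WeakBound μ θ g' M') {E : Set X} (hE : μ E ≠ ∞) :
    ∫⁻ x in E, g x * g' x ∂μ ≤
      ENNReal.ofReal (1 - 2 * θ)⁻¹ * M * M' * μ E ^ (1 - 2 * θ) := by
  have hsq : ∀ {f : X → ℝ≥0∞} {N : ℝ≥0∞}, Measurable f → WeakBound μ θ f N →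
      (∫⁻ x in E, f x ^ (2 : ℝ) ∂μ) ^ (1 / 2 : ℝ) ≤
        (ENNReal.ofReal (1 - 2 * θ)⁻¹ * μ E ^ (1 - 2 * θ)) ^ (1 / 2 : ℝ) * N := by
    intro f N hf hN
    have h1 := hN.sq.setLIntegral_le (by linarith) (by linarith) (hf.pow_const 2) hE
    have h2 : N = (N ^ 2) ^ (1 / 2 : ℝ) := by
      rw [← ENNReal.rpow_natCast, ← ENNReal.rpow_mul]; norm_num
    conv_rhs => rw [h2, ← ENNReal.mul_rpow_of_nonneg _ _ (by norm_num)]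
    refine ENNReal.rpow_le_rpow ?_ (by norm_num)
    refine le_trans (le_of_eq ?_) (h1.trans_eq (by ring))
    simp
  refine (ENNReal.lintegral_mul_le_Lp_mul_Lq (μ.restrict E) Real.HolderConjugate.two_two
    hg.aemeasurable hg'.aemeasurable).trans ?_
  refine (mul_le_mul' (hsq hg h) (hsq hg' h')).trans_eq ?_
  generalize ENNReal.ofReal (1 - 2 * θ)⁻¹ = c
  generalize μ E ^ (1 - 2 * θ) = e
  have : (c * e) ^ (1 / 2 : ℝ) * (c * e) ^ (1 / 2 : ℝ) = c * e := by
    rw [← ENNReal.rpow_add_of_nonneg _ _ (by norm_num) (by norm_num)]; norm_num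
  calc _ = ((c * e) ^ (1 / 2 : ℝ) * (c * e) ^ (1 / 2 : ℝ)) * M * M' := by ring
    _ = _ := by rw [this]; ring

/-- A bound for integrals over sets of finite measure implies a weak-type bound. -/
theorem weakBound_of_setLIntegral_le [SigmaFinite μ] (hθ0 : 0 ≤ θ)
    (hg : Measurable g)
    (h : ∀ E, MeasurableSet E → μ E ≠ ∞ → ∫⁻ x in E, g x ∂μ ≤ M * μ E ^ (1 - θ)) :
    WeakBound μ θ g M := by
  intro y
  set A := {x | y < g x} with hA
  have hAm : MeasurableSet A := measurableSet_lt measurable_const hg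
  by_cases hA0 : μ A = 0
  · simp [posRpow, hA0]
  rw [posRpow, if_neg hA0]
  -- Chebyshev on subsets of finite measure. The full superlevel set may have infinite measure, so
  -- it is reached by exhaustion along the spanning sets.
  have key : ∀ E ⊆ A, MeasurableSet E → μ E ≠ ∞ → μ E ≠ 0 → y * μ E ^ θ ≤ M := by
    intro E hEA hEm hE hE0
    have h1 : y * μ E ≤ M * μ E ^ (1 - θ) := by
      refine le_trans ?_ (h E hEm hE)
      rw [← setLIntegral_const]
      exact setLIntegral_mono' hEm fun x hx => (hEA hx).le
    rw [ENNReal.rpow_sub _ _ hE0 hE, ENNReal.rpow_one, ← mul_div_assoc,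
      ENNReal.le_div_iff_mul_le (Or.inl (by simp [hE0, hE]))
        (Or.inl (by simp [hE0, hE]))] at h1
    have h2 : (y * μ E ^ θ) * μ E ≤ M * μ E := by
      calc _ = y * μ E * μ E ^ θ := by ring
        _ ≤ _ := h1
    exact (ENNReal.mul_le_mul_iff_left hE0 hE).1 h2
  have hlim : Filter.Tendsto (fun k => μ (A ∩ spanningSets μ k)) Filter.atTop
      (nhds (μ A)) := by
    have := tendsto_measure_iUnion_atTop (μ := μ) (s := fun k => A ∩ spanningSets μ k)
      (fun i j hij => inter_subset_inter_right A (monotone_spanningSets μ hij))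
    rwa [← inter_iUnion, iUnion_spanningSets, inter_univ] at this
  have hlim2 : Filter.Tendsto (fun k => y * μ (A ∩ spanningSets μ k) ^ θ) Filter.atTop
      (nhds (y * μ A ^ θ)) :=
    ENNReal.Tendsto.const_mul ((ENNReal.continuous_rpow_const.tendsto _).comp hlim)
      (Or.inl (by simp [hA0, hθ0, ENNReal.rpow_eq_zero_iff, not_lt]))
  refine le_of_tendsto hlim2 ?_
  filter_upwards [hlim.eventually_ne hA0] with k hk
  exact key _ inter_subset_left (hAm.inter (measurableSet_spanningSets μ k))
    ((measure_mono inter_subset_right).trans_lt (measure_spanningSets_lt_top μ k)).ne hk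

theorem posRpow_add_le (hθ0 : 0 ≤ θ) (hθ : θ ≤ 1) (a b : ℝ≥0∞) :
    posRpow θ (a + b) ≤ posRpow θ a + posRpow θ b := by
  unfold posRpow
  by_cases ha : a = 0
  · simp [ha]
  by_cases hb : b = 0
  · simp [hb]
  rw [if_neg ha, if_neg hb, if_neg (by simp [ha])]
  exact ENNReal.rpow_add_le_add_rpow _ _ hθ0 hθ

/-- If g + g' exceeds y, one of the two exceeds y/2, and l ↦ l^θ is subadditive for θ ≤ 1. Halving
the level costs the factor 2. -/
theorem WeakBound.add (hθ0 : 0 ≤ θ) (hθ : θ ≤ 1) {g' : X → ℝ≥0∞} {M' : ℝ≥0∞}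
    (h : WeakBound μ θ g M) (h' : WeakBound μ θ g' M') :
    WeakBound μ θ (fun x => g x + g' x) (2 * (M + M')) := by
  intro y
  have hsub : {x | y < g x + g' x} ⊆ {x | y / 2 < g x} ∪ {x | y / 2 < g' x} := by
    intro x hx
    by_contra hc
    simp only [mem_union, mem_ofPred_eq, not_or, not_lt] at hc
    have : g x + g' x ≤ y := (add_le_add hc.1 hc.2).trans_eq (ENNReal.add_halves y)
    exact absurd hx (not_lt.2 this)
  have h1 : posRpow θ (μ {x | y < g x + g' x}) ≤
      posRpow θ (μ {x | y / 2 < g x}) + posRpow θ (μ {x | y / 2 < g' x}) :=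
    (posRpow_mono hθ0 ((measure_mono hsub).trans (measure_union_le _ _))).trans
      (posRpow_add_le hθ0 hθ _ _)
  calc y * posRpow θ (μ {x | y < g x + g' x})
      ≤ y * (posRpow θ (μ {x | y / 2 < g x}) + posRpow θ (μ {x | y / 2 < g' x})) := by gcongr
    _ = 2 * (y / 2 * posRpow θ (μ {x | y / 2 < g x}) +
          y / 2 * posRpow θ (μ {x | y / 2 < g' x})) := by
        rw [← mul_add, ← mul_assoc, ENNReal.mul_div_cancel (by simp) (by simp)]
    _ ≤ _ := by gcongr; exacts [h _, h' _]

theorem WeakBound.mono (hθ0 : 0 ≤ θ) {g' : X → ℝ≥0∞} (h : WeakBound μ θ g M)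
    (hg : ∀ᵐ x ∂μ, g' x ≤ g x) : WeakBound μ θ g' M := by
  intro y
  refine le_trans ?_ (h y)
  gcongr
  refine posRpow_mono hθ0 (measure_mono_ae ?_)
  filter_upwards [hg] with x hx hy
  exact lt_of_lt_of_le hy hx

theorem WeakBound.ae_eq_zero (hθ0 : 0 ≤ θ) (h : WeakBound μ θ g 0) : ∀ᵐ x ∂μ, g x = 0 := by
  have h1 : ∀ k : ℕ, ∀ᵐ x ∂μ, g x ≤ (k + 1 : ℝ≥0∞)⁻¹ := by
    intro k
    have h2 := h (k + 1 : ℝ≥0∞)⁻¹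
    rw [ae_iff]
    simp only [not_le]
    by_contra hc
    rw [posRpow, if_neg hc, nonpos_iff_eq_zero, mul_eq_zero] at h2
    rcases h2 with h2 | h2
    · simp at h2
    · simp [ENNReal.rpow_eq_zero_iff, hc, not_lt.2 hθ0] at h2
  filter_upwards [ae_all_iff.2 h1] with x hx
  refine le_antisymm (le_of_forall_pos_le_add fun ε hε => ?_) zero_le
  obtain ⟨k, hk⟩ := ENNReal.exists_inv_nat_lt hε.ne'
  refine (hx k).trans ?_
  rw [zero_add]
  refine le_trans (ENNReal.inv_le_inv.2 ?_) hk.le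
  exact le_self_add

/-- The least constant in a weak-type bound, as a countable supremum. -/
def weakNorm (μ : Measure X) (θ : ℝ) (g : X → ℝ≥0∞) : ℝ≥0∞ :=
  ⨆ q : ℚ, ENNReal.ofReal (q : ℝ) * posRpow θ (μ {x | ENNReal.ofReal (q : ℝ) < g x})

theorem weakNorm_le (h : WeakBound μ θ g M) : weakNorm μ θ g ≤ M :=
  iSup_le fun _ => h _

/-- Rational levels suffice: a violation at level y persists at a slightly smaller rational level,
since the superlevel set only grows. -/
theorem weakBound_weakNorm (hθ0 : 0 ≤ θ) : WeakBound μ θ g (weakNorm μ θ g) := by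
  intro y
  by_contra! hc
  set L := posRpow θ (μ {x | y < g x}) with hL
  have hL0 : L ≠ 0 := fun h => by simp [h] at hc
  have hy0 : y ≠ 0 := fun h => by simp [h] at hc
  have : weakNorm μ θ g / L < y := by
    refine (ENNReal.div_lt_iff (Or.inl hL0) ?_).2 hc
    right
    exact (ne_top_of_lt hc)
  obtain ⟨q, hq0, hq1, hq2⟩ := ENNReal.lt_iff_exists_rat_btwn.1 this
  have h1 : ENNReal.ofReal q * L ≤ weakNorm μ θ g := by
    refine le_trans ?_ (le_iSup (fun q : ℚ => ENNReal.ofReal q *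
      posRpow θ (μ {x | ENNReal.ofReal q < g x})) q)
    gcongr
    exact posRpow_mono hθ0 (measure_mono fun x hx => lt_trans hq2 hx)
  have h2 : weakNorm μ θ g < ENNReal.ofReal q * L := by
    refine (ENNReal.div_lt_iff (Or.inl hL0) ?_).1 hq1
    right
    exact (ne_top_of_lt hc)
  exact absurd h1 (not_le.2 h2)

theorem measurable_posRpow (hθ0 : 0 ≤ θ) : Measurable (posRpow θ) :=
  (posRpow_mono hθ0).measurable

/-- This is why the weak norm is taken over countably many levels: time slices then have measurable
norms, which is not immediate for an uncountable supremum. -/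
theorem measurable_weakNorm {S : Type*} [MeasurableSpace S] [SFinite μ] (hθ0 : 0 ≤ θ)
    {u : S → X → ℝ≥0∞} (hu : Measurable (Function.uncurry u)) :
    Measurable fun s => weakNorm μ θ (u s) := by
  refine Measurable.iSup fun q => Measurable.const_mul ?_ _
  refine (measurable_posRpow hθ0).comp ?_
  exact measurable_measure_prodMk_left
    (measurableSet_lt (measurable_const (a := ENNReal.ofReal q)) hu)

theorem weakNorm_congr {g' : X → ℝ≥0∞} (h : ∀ᵐ x ∂μ, g x = g' x) :
    weakNorm μ θ g = weakNorm μ θ g' := by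
  unfold weakNorm
  refine iSup_congr fun q => ?_
  rw [measure_congr (s := {x | ENNReal.ofReal (q : ℝ) < g x})
    (t := {x | ENNReal.ofReal (q : ℝ) < g' x})]
  filter_upwards [h] with x hx
  refine propext ?_
  change ENNReal.ofReal (q : ℝ) < g x ↔ ENNReal.ofReal (q : ℝ) < g' x
  rw [hx]

end

/-! ### The Oseen kernel -/

/-- One term of the exponential series dominates the power by e^{t(1+r)}, and t(1+r) - tr² ≤ 2t
because 1 - r + r² ≥ 0. -/
theorem one_add_pow_mul_exp_neg_le (N : ℕ) {t r : ℝ} (ht : 0 < t) (hr : 0 ≤ r) :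
    (1 + r) ^ N * Real.exp (-(t * r ^ 2)) ≤ N.factorial / t ^ N * Real.exp (2 * t) := by
  have h1 : (t * (1 + r)) ^ N / N.factorial ≤ Real.exp (t * (1 + r)) :=
    Real.pow_div_factorial_le_exp _ (by positivity) N
  have h2 : (1 + r) ^ N ≤ N.factorial / t ^ N * Real.exp (t * (1 + r)) := by
    rw [mul_pow, div_le_iff₀ (by positivity)] at h1
    rw [div_mul_eq_mul_div, le_div_iff₀ (by positivity)]
    linarith
  calc (1 + r) ^ N * Real.exp (-(t * r ^ 2))
      ≤ (N.factorial / t ^ N * Real.exp (t * (1 + r))) * Real.exp (-(t * r ^ 2)) := by gcongr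
    _ = N.factorial / t ^ N * Real.exp (t * (1 + r) + -(t * r ^ 2)) := by
        rw [mul_assoc, Real.exp_add]
    _ ≤ _ := by
        gcongr
        nlinarith [mul_nonneg ht.le (sq_nonneg (r - 1)), mul_nonneg ht.le hr]

theorem hasTemperateGrowth_norm_sq {n : ℕ} :
    Function.HasTemperateGrowth (fun ξ : Rn n => ‖ξ‖ ^ 2) := by
  fun_prop

/-- The Gaussian `ξ ↦ exp (-t|ξ|²)` as a Schwartz function. -/
def gaussianSchwartz (n : ℕ) (t : ℝ) (ht : 0 < t) : SchwartzMap (Rn n) ℝ where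
  toFun ξ := Real.exp (-(t * ‖ξ‖ ^ 2))
  smooth' := Real.contDiff_exp.comp (contDiff_const.mul (contDiff_norm_sq ℝ)).neg
  decay' := by
    intro k m
    have htg : Function.HasTemperateGrowth (fun ξ : Rn n => -(t * ‖ξ‖ ^ 2)) := by
      have := hasTemperateGrowth_norm_sq (n := n)
      fun_prop
    obtain ⟨K, C, hC, hf⟩ := htg.norm_iteratedFDeriv_le_uniform m
    refine ⟨m.factorial * (max 1 C) ^ m *
      (((k + K * m).factorial : ℝ) / t ^ (k + K * m) * Real.exp (2 * t)), fun x => ?_⟩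
    -- The Faà di Bruno estimate for exp ∘ (-t|ξ|²) wants inner derivatives bounded by D^i with a
    -- single D. Replacing C by max 1 C makes D ≥ 1, so that D ≤ D^i.
    have hD : ∀ i, 1 ≤ i → i ≤ m → ‖iteratedFDeriv ℝ i (fun ξ : Rn n => -(t * ‖ξ‖ ^ 2)) x‖ ≤
        (max 1 C * (1 + ‖x‖) ^ K) ^ i := by
      intro i hi him
      have h1 : 1 ≤ max 1 C * (1 + ‖x‖) ^ K := by
        have : (1 : ℝ) ≤ (1 + ‖x‖) ^ K := one_le_pow₀ (by linarith [norm_nonneg x])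
        nlinarith [le_max_left 1 C]
      refine (hf i him x).trans (le_trans ?_ (le_self_pow₀ h1 (by omega)))
      gcongr
      exact le_max_right _ _
    have hexp : ∀ i, i ≤ m → ‖iteratedFDeriv ℝ i Real.exp (-(t * ‖x‖ ^ 2))‖ ≤
        Real.exp (-(t * ‖x‖ ^ 2)) := by
      intro i _
      rw [norm_iteratedFDeriv_eq_norm_iteratedDeriv, iteratedDeriv_eq_iterate, Real.iter_deriv_exp]
      simp
    have := norm_iteratedFDeriv_comp_le (g := Real.exp) (f := fun ξ : Rn n => -(t * ‖ξ‖ ^ 2))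
      (n := m) (N := m) (Real.contDiff_exp.of_le le_top)
      (contDiff_const.mul (contDiff_norm_sq ℝ)).neg le_rfl x hexp hD
    calc ‖x‖ ^ k * ‖iteratedFDeriv ℝ m (fun ξ : Rn n => Real.exp (-(t * ‖ξ‖ ^ 2))) x‖
        ≤ (1 + ‖x‖) ^ k * (m.factorial * Real.exp (-(t * ‖x‖ ^ 2)) *
            (max 1 C * (1 + ‖x‖) ^ K) ^ m) := by
          gcongr
          · linarith
          · exact this
      _ = m.factorial * (max 1 C) ^ m *
            ((1 + ‖x‖) ^ (k + K * m) * Real.exp (-(t * ‖x‖ ^ 2))) := by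
          rw [mul_pow, ← pow_mul, pow_add]; ring
      _ ≤ _ := by
          exact mul_le_mul_of_nonneg_left (one_add_pow_mul_exp_neg_le _ ht (norm_nonneg x))
            (by positivity)

theorem integrable_pow_mul_gaussian (n d : ℕ) {t : ℝ} (ht : 0 < t) :
    Integrable (fun ξ : Rn n => ‖ξ‖ ^ d * Real.exp (-(t * ‖ξ‖ ^ 2))) := by
  have := (gaussianSchwartz n t ht).integrable_pow_mul (μ := volume) d
  refine this.congr (Filter.Eventually.of_forall fun ξ => ?_)
  have : gaussianSchwartz n t ht ξ = Real.exp (-(t * ‖ξ‖ ^ 2)) := rfl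
  simp only [this, Real.norm_eq_abs, Real.abs_exp]

/-! ### Gaussian Fourier integrals: scaling, integrability and differentiation. -/

/-- The Fourier integral `∫ e^{i x·ξ - t|ξ|²} p(ξ) dξ`. -/
def gaussFourier {n : ℕ} (p : Rn n → ℝ) (t : ℝ) (x : Rn n) : ℂ :=
  ∫ ξ : Rn n, Complex.exp (Complex.I * (inner ℝ x ξ : ℝ) - (t * ‖ξ‖ ^ 2 : ℝ)) * (p ξ : ℂ)

theorem norm_cexp_phase {n : ℕ} (t : ℝ) (x ξ : Rn n) :
    ‖Complex.exp (Complex.I * (inner ℝ x ξ : ℝ) - (t * ‖ξ‖ ^ 2 : ℝ))‖ =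
      Real.exp (-(t * ‖ξ‖ ^ 2)) := by
  rw [Complex.norm_exp, Complex.sub_re, Complex.ofReal_re]
  congr 1
  simp

theorem integrable_gaussFourier {n : ℕ} {p : Rn n → ℝ} (hp : Measurable p) {d : ℕ} {C : ℝ}
    (hpC : ∀ ξ, |p ξ| ≤ C * ‖ξ‖ ^ d) {t : ℝ} (ht : 0 < t) (x : Rn n) :
    Integrable fun ξ : Rn n =>
      Complex.exp (Complex.I * (inner ℝ x ξ : ℝ) - (t * ‖ξ‖ ^ 2 : ℝ)) * (p ξ : ℂ) := by
  refine ((integrable_pow_mul_gaussian n d ht).const_mul C).mono' ?_ ?_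
  · exact (Measurable.aestronglyMeasurable (by fun_prop))
  · refine Filter.Eventually.of_forall fun ξ => ?_
    rw [norm_mul, norm_cexp_phase, Complex.norm_real, Real.norm_eq_abs]
    nlinarith [hpC ξ, Real.exp_pos (-(t * ‖ξ‖ ^ 2))]

theorem measurable_gaussFourier {n : ℕ} {p : Rn n → ℝ} (hp : Measurable p) :
    Measurable fun z : ℝ × Rn n => gaussFourier p z.1 z.2 := by
  have : StronglyMeasurable fun w : (ℝ × Rn n) × Rn n =>
      Complex.exp (Complex.I * (inner ℝ w.1.2 w.2 : ℝ) - (w.1.1 * ‖w.2‖ ^ 2 : ℝ)) *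
        (p w.2 : ℂ) := by
    apply Measurable.stronglyMeasurable
    fun_prop
  exact (this.integral_prod_right (ν := volume)).measurable

/-- Substitute ξ ↦ t^{-1/2} ξ: the Jacobian gives n powers of t^{-1/2} and the homogeneity of the
symbol d more. All time dependence of the kernels is read off from this. -/
theorem gaussFourier_scale {n : ℕ} {p : Rn n → ℝ} {d : ℕ}
    (hp : ∀ c : ℝ, 0 < c → ∀ ξ, p (c • ξ) = c ^ d * p ξ) {t : ℝ} (ht : 0 < t) (x : Rn n) :
    gaussFourier p t x = (((√t)⁻¹ ^ (n + d) : ℝ) : ℂ) * gaussFourier p 1 ((√t)⁻¹ • x) := by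
  set c := (√t)⁻¹ with hc
  have hc0 : 0 < c := by positivity
  have htc : t * c ^ 2 = 1 := by
    rw [hc, inv_pow, Real.sq_sqrt ht.le, mul_inv_cancel₀ ht.ne']
  have h := Measure.integral_comp_smul (volume : Measure (Rn n)) (fun ξ : Rn n =>
    Complex.exp (Complex.I * (inner ℝ x ξ : ℝ) - (t * ‖ξ‖ ^ 2 : ℝ)) * (p ξ : ℂ)) c
  have h2 : ∀ ξ : Rn n, Complex.exp (Complex.I * (inner ℝ x (c • ξ) : ℝ) -
      (t * ‖c • ξ‖ ^ 2 : ℝ)) * (p (c • ξ) : ℂ) = ((c ^ d : ℝ) : ℂ) *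
      (Complex.exp (Complex.I * (inner ℝ (c • x) ξ : ℝ) - (1 * ‖ξ‖ ^ 2 : ℝ)) * (p ξ : ℂ)) := by
    intro ξ
    rw [hp c hc0, norm_smul, mul_pow, Real.norm_eq_abs, sq_abs, ← mul_assoc, htc, inner_smul_left,
      inner_smul_right]
    push_cast
    simp
    ring
  simp only [h2] at h
  rw [integral_const_mul] at h
  have hn : Module.finrank ℝ (Rn n) = n := by simp
  rw [hn, abs_of_pos (by positivity)] at h
  change _ = _ • gaussFourier p t x at h
  have h3 : gaussFourier p t x = (c ^ n : ℝ) • ((c ^ n)⁻¹ • gaussFourier p t x) := by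
    rw [smul_smul, mul_inv_cancel₀ (by positivity), one_smul]
  rw [h3, ← h, Complex.real_smul, pow_add]
  push_cast
  rw [gaussFourier]
  push_cast
  ring

/-- A Gaussian Fourier integral with Schwartz integrand is integrable. -/
theorem integrable_gaussFourier_one {n : ℕ} {p : Rn n → ℝ} (hp : p.HasTemperateGrowth) :
    Integrable (gaussFourier p 1) := by
  let f : SchwartzMap (Rn n) ℂ := SchwartzMap.postcompCLM (𝕜 := ℝ) Complex.ofRealCLM
    (SchwartzMap.smulLeftCLM ℝ p (gaussianSchwartz n 1 one_pos))
  have hf : ∀ ξ, f ξ = ((p ξ * Real.exp (-(1 * ‖ξ‖ ^ 2)) : ℝ) : ℂ) := by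
    intro ξ
    have h1 : SchwartzMap.smulLeftCLM ℝ p (gaussianSchwartz n 1 one_pos) ξ =
        p ξ • gaussianSchwartz n 1 one_pos ξ := SchwartzMap.smulLeftCLM_apply_apply hp _ _
    have h2 : f ξ = Complex.ofRealCLM
        (SchwartzMap.smulLeftCLM ℝ p (gaussianSchwartz n 1 one_pos) ξ) := rfl
    rw [h2, h1]
    rfl
  -- The argument is rescaled by (2π)^{-1} to match the convention e^{2πi x·ξ} of the inverse
  -- Fourier transform.
  have hF : ∀ x, gaussFourier p 1 x =
      (FourierTransformInv.fourierInv f : SchwartzMap (Rn n) ℂ) ((2 * Real.pi)⁻¹ • x) := by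
    intro x
    rw [SchwartzMap.fourierInv_coe, Real.fourierInv_eq', gaussFourier]
    refine integral_congr_ae (Filter.Eventually.of_forall fun ξ => ?_)
    simp only [hf, smul_eq_mul]
    push_cast
    rw [mul_comm (p ξ : ℂ), ← mul_assoc, ← Complex.exp_add]
    congr 2
    rw [inner_smul_right, real_inner_comm]
    push_cast
    have : (Real.pi : ℂ) ≠ 0 := by simp [Real.pi_ne_zero]
    field_simp
    ring
  have := (FourierTransformInv.fourierInv f : SchwartzMap (Rn n) ℂ).integrable (μ := volume)
  have h2 := (integrable_comp_smul_iff (volume : Measure (Rn n))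
    (fun x => (FourierTransformInv.fourierInv f : SchwartzMap (Rn n) ℂ) x)
    (R := (2 * Real.pi)⁻¹) (by positivity)).2 this
  exact h2.congr (Filter.Eventually.of_forall fun x => (hF x).symm)

theorem lintegral_gaussFourier {n : ℕ} {p : Rn n → ℝ} {d : ℕ}
    (hp : ∀ c : ℝ, 0 < c → ∀ ξ, p (c • ξ) = c ^ d * p ξ) (hpm : Measurable p)
    {t : ℝ} (ht : 0 < t) :
    ∫⁻ x, ‖gaussFourier p t x‖ₑ =
      ENNReal.ofReal ((√t)⁻¹ ^ d) * ∫⁻ x, ‖gaussFourier p 1 x‖ₑ := by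
  set c := (√t)⁻¹ with hc
  have hc0 : 0 < c := by positivity
  have hm : Measurable fun x => ‖gaussFourier p 1 x‖ₑ :=
    ((measurable_gaussFourier hpm).comp (measurable_const.prodMk measurable_id)).enorm
  have h1 : ∀ x, ‖gaussFourier p t x‖ₑ =
      ENNReal.ofReal (c ^ (n + d)) * ‖gaussFourier p 1 (c • x)‖ₑ := by
    intro x
    rw [gaussFourier_scale hp ht x, enorm_mul, ← hc]
    congr 1
    rw [← ofReal_norm, Complex.norm_real, Real.norm_of_nonneg (by positivity)]
  have h2 : ∫⁻ x, ‖gaussFourier p 1 (c • x)‖ₑ =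
      ENNReal.ofReal ((c ^ n)⁻¹) * ∫⁻ x, ‖gaussFourier p 1 x‖ₑ := by
    rw [← lintegral_map (f := fun x => ‖gaussFourier p 1 x‖ₑ) (g := fun x : Rn n => c • x) hm
      (measurable_const_smul c), Measure.map_addHaar_smul _ hc0.ne', lintegral_smul_measure]
    simp [abs_of_pos hc0]
  simp only [h1]
  rw [lintegral_const_mul (f := fun x => ‖gaussFourier p 1 (c • x)‖ₑ) _
      (hm.comp (measurable_const_smul c)), h2, ← mul_assoc,
    ← ENNReal.ofReal_mul (by positivity)]
  congr 2
  rw [pow_add]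
  field_simp

/-- The spatial derivative of the integrand of `gaussFourier`. -/
def gaussFourierDeriv {n : ℕ} (p : Rn n → ℝ) (t : ℝ) (x ξ : Rn n) : Rn n →L[ℝ] ℂ :=
  (Complex.exp (Complex.I * (inner ℝ x ξ : ℝ) - (t * ‖ξ‖ ^ 2 : ℝ)) * (p ξ : ℂ) * Complex.I) •
    (Complex.ofRealCLM.comp (innerSL ℝ ξ))

theorem norm_gaussFourierDeriv_le {n : ℕ} {p : Rn n → ℝ} {d : ℕ} {C : ℝ}
    (hpC : ∀ ξ, |p ξ| ≤ C * ‖ξ‖ ^ d) (t : ℝ) (x ξ : Rn n) :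
    ‖gaussFourierDeriv p t x ξ‖ ≤ C * (‖ξ‖ ^ (d + 1) * Real.exp (-(t * ‖ξ‖ ^ 2))) := by
  have h1 : ‖Complex.ofRealCLM.comp (innerSL ℝ ξ)‖ ≤ ‖ξ‖ := by
    refine (ContinuousLinearMap.opNorm_comp_le _ _).trans ?_
    simp
  rw [gaussFourierDeriv, norm_smul, norm_mul, norm_mul, norm_cexp_phase, Complex.norm_real,
    Real.norm_eq_abs, Complex.norm_I, mul_one]
  calc Real.exp (-(t * ‖ξ‖ ^ 2)) * |p ξ| * ‖Complex.ofRealCLM.comp (innerSL ℝ ξ)‖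
      ≤ Real.exp (-(t * ‖ξ‖ ^ 2)) * (C * ‖ξ‖ ^ d) * ‖ξ‖ := by
        gcongr
        · exact mul_nonneg (Real.exp_pos _).le ((abs_nonneg _).trans (hpC ξ))
        · exact hpC ξ
    _ = _ := by ring

theorem aestronglyMeasurable_gaussFourierDeriv {n : ℕ} {p : Rn n → ℝ} (hp : Measurable p)
    (t : ℝ) (x : Rn n) : AEStronglyMeasurable (gaussFourierDeriv p t x) volume := by
  have h1 : AEStronglyMeasurable (fun ξ : Rn n => Complex.exp (Complex.I * (inner ℝ x ξ : ℝ) -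
      (t * ‖ξ‖ ^ 2 : ℝ)) * (p ξ : ℂ) * Complex.I) volume :=
    Measurable.aestronglyMeasurable (by fun_prop)
  have h2 : AEStronglyMeasurable (fun ξ : Rn n => Complex.ofRealCLM.comp (innerSL ℝ ξ))
      volume := Continuous.aestronglyMeasurable (by fun_prop)
  exact h1.smul h2

/-- Differentiation under the integral: the phase has modulus one, so the differentiated integrand
has a Gaussian majorant independent of the point. -/
theorem hasFDerivAt_gaussFourier {n : ℕ} {p : Rn n → ℝ} (hp : Measurable p) {d : ℕ} {C : ℝ}
    (hpC : ∀ ξ, |p ξ| ≤ C * ‖ξ‖ ^ d) {t : ℝ} (ht : 0 < t) (x : Rn n) :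
    HasFDerivAt (gaussFourier p t) (∫ ξ : Rn n, gaussFourierDeriv p t x ξ) x := by
  refine hasFDerivAt_integral_of_dominated_of_fderiv_le (𝕜 := ℝ) (F' := gaussFourierDeriv p t)
    (F := fun x ξ => Complex.exp (Complex.I * (inner ℝ x ξ : ℝ) - (t * ‖ξ‖ ^ 2 : ℝ)) * (p ξ : ℂ))
    (bound := fun ξ => C * (‖ξ‖ ^ (d + 1) * Real.exp (-(t * ‖ξ‖ ^ 2))))
    (s := univ) Filter.univ_mem ?_ ?_ ?_ ?_ ?_ ?_
  · exact Filter.Eventually.of_forall fun y =>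
      (integrable_gaussFourier hp hpC ht y).aestronglyMeasurable
  · exact integrable_gaussFourier hp hpC ht x
  · exact aestronglyMeasurable_gaussFourierDeriv hp t x
  · exact Filter.Eventually.of_forall fun ξ y _ => norm_gaussFourierDeriv_le hpC t y ξ
  · exact (integrable_pow_mul_gaussian n (d + 1) ht).const_mul C
  · refine Filter.Eventually.of_forall fun ξ y _ => ?_
    have h1 : HasFDerivAt (fun y : Rn n => (inner ℝ y ξ : ℝ)) (innerSL ℝ ξ) y := by
      have := (innerSL ℝ ξ).hasFDerivAt (x := y)
      refine this.congr_of_eventuallyEq (Filter.Eventually.of_forall fun z => ?_)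
      simp [real_inner_comm]
    have h2 : HasFDerivAt (fun y : Rn n => ((inner ℝ y ξ : ℝ) : ℂ))
      (Complex.ofRealCLM.comp (innerSL ℝ ξ)) y := Complex.ofRealCLM.hasFDerivAt.comp y h1
    have h3 := (((h2.const_mul Complex.I).sub_const ((t * ‖ξ‖ ^ 2 : ℝ) : ℂ)).cexp).mul_const
      (p ξ : ℂ)
    refine h3.congr_fderiv ?_
    ext z
    simp [gaussFourierDeriv]
    ring

theorem fderiv_gaussFourier_apply {n : ℕ} {p : Rn n → ℝ} (hp : Measurable p) {d : ℕ} {C : ℝ}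
    (hpC : ∀ ξ, |p ξ| ≤ C * ‖ξ‖ ^ d) {t : ℝ} (ht : 0 < t) (x : Rn n) (k : Fin n) :
    (fderiv ℝ (gaussFourier p t) x) (EuclideanSpace.single k 1) =
      Complex.I * gaussFourier (fun ξ => ξ k * p ξ) t x := by
  rw [(hasFDerivAt_gaussFourier hp hpC ht x).fderiv, ContinuousLinearMap.integral_apply,
    gaussFourier, ← integral_const_mul]
  · refine integral_congr_ae (Filter.Eventually.of_forall fun ξ => ?_)
    simp [gaussFourierDeriv, EuclideanSpace.inner_single_right]
    ring
  · exact ((integrable_pow_mul_gaussian n (d + 1) ht).const_mul C).mono'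
      (aestronglyMeasurable_gaussFourierDeriv hp t x)
      (Filter.Eventually.of_forall fun ξ => norm_gaussFourierDeriv_le hpC t x ξ)

/-! ### The Leray symbol, with L¹ and supremum bounds for the kernel gradient. -/

/-- The symbol `δ_{ij} - ξ_i ξ_j / |ξ|²` of the Leray projection. -/
def leraySymbol {n : ℕ} (i j : Fin n) (ξ : Rn n) : ℝ :=
  (if i = j then 1 else 0) - ξ i * ξ j / ‖ξ‖ ^ 2

theorem measurable_leraySymbol {n : ℕ} (i j : Fin n) : Measurable (leraySymbol i j) := by
  unfold leraySymbol
  fun_prop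

theorem abs_coord_le {n : ℕ} (ξ : Rn n) (i : Fin n) : |ξ i| ≤ ‖ξ‖ := by
  simpa using PiLp.norm_apply_le ξ i

theorem abs_leraySymbol_le {n : ℕ} (i j : Fin n) (ξ : Rn n) : |leraySymbol i j ξ| ≤ 2 := by
  unfold leraySymbol
  have h1 : |ξ i * ξ j / ‖ξ‖ ^ 2| ≤ 1 := by
    rw [abs_div, abs_mul, abs_of_nonneg (sq_nonneg ‖ξ‖)]
    refine div_le_one_of_le₀ ?_ (sq_nonneg _)
    rw [sq]
    gcongr <;> exact abs_coord_le ξ _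
  have h2 : |(if i = j then (1 : ℝ) else 0)| ≤ 1 := by split_ifs <;> simp
  refine (abs_sub _ _).trans ?_
  linarith

theorem gradOseen_eq {n : ℕ} (k i j : Fin n) {t : ℝ} (ht : 0 < t) (x : Rn n) :
    gradOseen k i j t x = (1 / (2 * (Real.pi : ℂ)) ^ n * (Complex.I *
      gaussFourier (fun ξ => ξ k * leraySymbol i j ξ) t x)).re := by
  have hC : ∀ ξ : Rn n, |leraySymbol i j ξ| ≤ 2 * ‖ξ‖ ^ 0 := fun ξ => by
    simpa using abs_leraySymbol_le i j ξ
  have hd := hasFDerivAt_gaussFourier (measurable_leraySymbol i j) hC ht x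
  have h1 : oseenKernel i j t = fun y => Complex.reCLM (1 / (2 * (Real.pi : ℂ)) ^ n *
    gaussFourier (leraySymbol i j) t y) := rfl
  have h2 := Complex.reCLM.hasFDerivAt.comp x (hd.const_mul (1 / (2 * (Real.pi : ℂ)) ^ n))
  have h3 : HasFDerivAt (oseenKernel i j t) _ x := h2
  rw [gradOseen, h3.fderiv, ← fderiv_gaussFourier_apply (measurable_leraySymbol i j) hC ht x k,
    hd.fderiv]
  simp

theorem abs_cubic_le {n : ℕ} (k i j : Fin n) (ξ : Rn n) : |ξ k * ξ i * ξ j| ≤ ‖ξ‖ ^ 3 := by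
  rw [abs_mul, abs_mul, pow_succ, sq]
  gcongr <;> exact abs_coord_le ξ _

theorem integrableOn_exp_neg_mul {a : ℝ} (ha : 0 < a) :
    IntegrableOn (fun s : ℝ => Real.exp (-(s * a))) (Ioi 1) := by
  have := integrableOn_exp_mul_Ioi (a := -a) (by linarith) 1
  refine this.congr_fun (fun s _ => ?_) measurableSet_Ioi
  change Real.exp (-a * s) = Real.exp (-(s * a))
  congr 1
  ring

theorem integral_exp_neg_mul {a : ℝ} (ha : 0 < a) :
    ∫ s in Ioi (1 : ℝ), Real.exp (-(s * a)) = Real.exp (-a) / a := by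
  have := integral_exp_mul_Ioi (a := -a) (by linarith) 1
  rw [mul_one, neg_div_neg_eq] at this
  rw [← this]
  refine setIntegral_congr_fun measurableSet_Ioi fun s _ => ?_
  congr 1
  ring

theorem cexp_phase_eq {n : ℕ} (s : ℝ) (x ξ : Rn n) (q : ℝ) :
    Complex.exp (Complex.I * (inner ℝ x ξ : ℝ) - (s * ‖ξ‖ ^ 2 : ℝ)) * (q : ℂ) =
      Complex.exp (Complex.I * (inner ℝ x ξ : ℝ)) * (q : ℂ) *
        ((Real.exp (-(s * ‖ξ‖ ^ 2)) : ℝ) : ℂ) := by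
  rw [sub_eq_add_neg, Complex.exp_add]
  push_cast
  ring

/-- The identity e^{-|ξ|²}/|ξ|² = ∫_1^∞ e^{-s|ξ|²} ds removes the singularity of the symbol at the
origin: what remains is a superposition of polynomial symbols, whose Gaussian Fourier integrals are
Schwartz. -/
theorem integral_gaussFourier_cubic {n : ℕ} (k i j : Fin n) (x : Rn n) :
    gaussFourier (fun ξ => ξ k * (ξ i * ξ j / ‖ξ‖ ^ 2)) 1 x =
      ∫ s in Ioi (1 : ℝ), gaussFourier (fun ξ => ξ k * ξ i * ξ j) s x := by
  set q : Rn n → ℝ := fun ξ => ξ k * ξ i * ξ j with hq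
  set F : Rn n → ℝ → ℂ := fun ξ s =>
    Complex.exp (Complex.I * (inner ℝ x ξ : ℝ) - (s * ‖ξ‖ ^ 2 : ℝ)) * (q ξ : ℂ) with hF
  have hFn : ∀ ξ s, ‖F ξ s‖ = |q ξ| * Real.exp (-(s * ‖ξ‖ ^ 2)) := by
    intro ξ s
    simp only [hF]
    rw [norm_mul, norm_cexp_phase, Complex.norm_real, Real.norm_eq_abs, mul_comm]
  have hq0 : q 0 = 0 := by simp [hq]
  have hint : Integrable (Function.uncurry F) (volume.prod (volume.restrict (Ioi (1 : ℝ)))) := by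
    rw [integrable_prod_iff (Measurable.aestronglyMeasurable (by
      simp only [hF, hq, Function.uncurry_def]; fun_prop))]
    constructor
    · refine Filter.Eventually.of_forall fun ξ => ?_
      by_cases hξ : ξ = 0
      · simp [hF, hξ, hq0]
      · have h1 := (integrableOn_exp_neg_mul (a := ‖ξ‖ ^ 2) (by positivity)).ofReal (𝕜 := ℂ)
        have h2 := h1.const_mul (Complex.exp (Complex.I * (inner ℝ x ξ : ℝ)) * (q ξ : ℂ))
        refine h2.congr (Filter.Eventually.of_forall fun s => ?_)
        simp only [Function.uncurry, hF, cexp_phase_eq]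
        rfl
    -- For Fubini, the s-integral of the modulus is |q(ξ)| e^{-|ξ|²}/|ξ|², and the cubic growth of q
    -- leaves at most |ξ| e^{-|ξ|²}.
    · simp only [Function.uncurry_apply_pair, hFn, integral_const_mul]
      refine (integrable_pow_mul_gaussian n 1 one_pos).mono'
        (AEStronglyMeasurable.mul (Measurable.aestronglyMeasurable (by
          simp only [hq]; fun_prop)) ?_) ?_
      · have hsm : StronglyMeasurable fun w : Rn n × ℝ => Real.exp (-(w.2 * ‖w.1‖ ^ 2)) :=
          Measurable.stronglyMeasurable (by fun_prop)
        exact (hsm.integral_prod_right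
          (ν := volume.restrict (Ioi (1 : ℝ)))).aestronglyMeasurable
      · refine Filter.Eventually.of_forall fun ξ => ?_
        by_cases hξ : ξ = 0
        · simp [hξ, hq0]
        · have hξ' : 0 < ‖ξ‖ := norm_pos_iff.2 hξ
          rw [integral_exp_neg_mul (by positivity), Real.norm_of_nonneg (by positivity),
            mul_div_assoc', div_le_iff₀ (by positivity), one_mul]
          have := mul_le_mul_of_nonneg_right (abs_cubic_le k i j ξ)
            (Real.exp_pos (-‖ξ‖ ^ 2)).le
          calc _ ≤ ‖ξ‖ ^ 3 * Real.exp (-‖ξ‖ ^ 2) := this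
            _ = _ := by ring
  have hswap := integral_integral_swap hint
  have hR : ∫ s in Ioi (1 : ℝ), gaussFourier q s x = ∫ s in Ioi (1 : ℝ), ∫ ξ, F ξ s := rfl
  rw [hR, ← hswap, gaussFourier]
  refine integral_congr_ae (Filter.Eventually.of_forall fun ξ => ?_)
  by_cases hξ : ξ = 0
  · simp [hF, hξ, hq0]
  · have hξ' : 0 < ‖ξ‖ := norm_pos_iff.2 hξ
    simp only [hF, cexp_phase_eq]
    rw [integral_const_mul, integral_complex_ofReal, integral_exp_neg_mul (by positivity)]
    have : (‖ξ‖ : ℂ) ≠ 0 := by exact_mod_cast hξ'.ne'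
    simp only [hq, one_mul]
    push_cast
    field_simp

theorem enorm_gaussFourier_leray_le {n : ℕ} (k i j : Fin n) (x : Rn n) :
    ‖gaussFourier (fun ξ => ξ k * leraySymbol i j ξ) 1 x‖ₑ ≤
      ‖gaussFourier (fun ξ => ξ k) 1 x‖ₑ +
      ∫⁻ s in Ioi (1 : ℝ), ‖gaussFourier (fun ξ => ξ k * ξ i * ξ j) s x‖ₑ := by
  have hk : ∀ ξ : Rn n, |ξ k| ≤ 1 * ‖ξ‖ ^ 1 := fun ξ => by simpa using abs_coord_le ξ k
  have hkij : ∀ ξ : Rn n, |ξ k * (ξ i * ξ j / ‖ξ‖ ^ 2)| ≤ 1 * ‖ξ‖ ^ 1 := by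
    intro ξ
    by_cases hξ : ξ = 0
    · simp [hξ]
    · have hξ' : 0 < ‖ξ‖ := norm_pos_iff.2 hξ
      rw [mul_div_assoc', abs_div, abs_of_pos (pow_pos hξ' 2), div_le_iff₀ (by positivity),
        ← mul_assoc]
      exact (abs_cubic_le k i j ξ).trans_eq (by ring)
  have h1 : gaussFourier (fun ξ => ξ k * leraySymbol i j ξ) 1 x =
      (if i = j then 1 else 0) * gaussFourier (fun ξ => ξ k) 1 x -
        ∫ s in Ioi (1 : ℝ), gaussFourier (fun ξ => ξ k * ξ i * ξ j) s x := by
    rw [← integral_gaussFourier_cubic, gaussFourier, gaussFourier, gaussFourier,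
      ← integral_const_mul, ← integral_sub]
    · refine integral_congr_ae (Filter.Eventually.of_forall fun ξ => ?_)
      simp only [leraySymbol]
      push_cast
      split_ifs <;> push_cast <;> ring
    · exact (integrable_gaussFourier (by fun_prop) hk one_pos x).const_mul _
    · exact integrable_gaussFourier (by fun_prop) hkij one_pos x
  rw [h1]
  refine (enorm_sub_le).trans (add_le_add ?_ (enorm_integral_le_lintegral_enorm _))
  split_ifs <;> simp

/-- The δ_{ij} part is Schwartz. The singular part is a superposition over s > 1 of cubic symbols,
whose L¹ norms scale like s^{-3/2}, which is integrable at infinity. -/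
theorem lintegral_gaussFourier_leray_lt_top {n : ℕ} (k i j : Fin n) :
    ∫⁻ x, ‖gaussFourier (fun ξ : Rn n => ξ k * leraySymbol i j ξ) 1 x‖ₑ < ∞ := by
  have hcoord : ∀ i : Fin n, Function.HasTemperateGrowth (fun ξ : Rn n => ξ i) := fun i =>
    (EuclideanSpace.proj i : Rn n →L[ℝ] ℝ).hasTemperateGrowth
  have hm : Measurable fun ξ : Rn n => ξ k * ξ i * ξ j := by fun_prop
  have hcubic : ∫⁻ x, ‖gaussFourier (fun ξ : Rn n => ξ k * ξ i * ξ j) 1 x‖ₑ < ∞ :=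
    (integrable_gaussFourier_one (((hcoord k).mul (hcoord i)).mul (hcoord j))).2
  have hlin : ∫⁻ x, ‖gaussFourier (fun ξ : Rn n => ξ k) 1 x‖ₑ < ∞ :=
    (integrable_gaussFourier_one (hcoord k)).2
  have hmeas : Measurable fun z : Rn n × ℝ => ‖gaussFourier (fun ξ => ξ k * ξ i * ξ j) z.2 z.1‖ₑ :=
    ((measurable_gaussFourier hm).comp measurable_swap).enorm
  have hmlin : Measurable fun x : Rn n => ‖gaussFourier (fun ξ => ξ k) 1 x‖ₑ :=
    ((measurable_gaussFourier (p := fun ξ : Rn n => ξ k) (by fun_prop)).comp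
      (measurable_const.prodMk measurable_id)).enorm
  calc ∫⁻ x, ‖gaussFourier (fun ξ : Rn n => ξ k * leraySymbol i j ξ) 1 x‖ₑ
      ≤ ∫⁻ x : Rn n, (‖gaussFourier (fun ξ => ξ k) 1 x‖ₑ +
          ∫⁻ s in Ioi (1 : ℝ), ‖gaussFourier (fun ξ => ξ k * ξ i * ξ j) s x‖ₑ) :=
        lintegral_mono fun x => enorm_gaussFourier_leray_le k i j x
    _ = (∫⁻ x : Rn n, ‖gaussFourier (fun ξ => ξ k) 1 x‖ₑ) + ∫⁻ s in Ioi (1 : ℝ), ∫⁻ x : Rn n,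
          ‖gaussFourier (fun ξ => ξ k * ξ i * ξ j) s x‖ₑ := by
        rw [lintegral_add_left hmlin, lintegral_lintegral_swap hmeas.aemeasurable]
    _ = (∫⁻ x : Rn n, ‖gaussFourier (fun ξ => ξ k) 1 x‖ₑ) + ∫⁻ s in Ioi (1 : ℝ),
          ENNReal.ofReal (s ^ (-(3 / 2) : ℝ)) *
            ∫⁻ x : Rn n, ‖gaussFourier (fun ξ => ξ k * ξ i * ξ j) 1 x‖ₑ := by
        congr 1
        refine setLIntegral_congr_fun measurableSet_Ioi fun s hs => ?_
        have hs0 : (0 : ℝ) < s := lt_trans one_pos hs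
        rw [lintegral_gaussFourier (d := 3) (fun c _ ξ => by simp; ring) hm hs0]
        congr 2
        rw [Real.sqrt_eq_rpow, ← Real.rpow_neg hs0.le, ← Real.rpow_natCast, ← Real.rpow_mul hs0.le]
        norm_num
    _ < ∞ := by
        rw [lintegral_mul_const _ (by fun_prop)]
        refine ENNReal.add_lt_top.2 ⟨hlin, ENNReal.mul_lt_top ?_ hcubic⟩
        have := (integrableOn_Ioi_rpow_of_lt (a := -(3 / 2)) (by norm_num)
          (c := 1) one_pos)
        have h2 := this.2
        refine lt_of_le_of_lt (lintegral_mono fun s => ?_) h2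
        exact Real.ofReal_le_enorm _

theorem leraySymbol_smul {n : ℕ} (k i j : Fin n) (c : ℝ) (hc : 0 < c) (ξ : Rn n) :
    (c • ξ) k * leraySymbol i j (c • ξ) = c ^ 1 * (ξ k * leraySymbol i j ξ) := by
  simp only [leraySymbol, norm_smul, PiLp.smul_apply, smul_eq_mul, Real.norm_of_nonneg hc.le]
  rw [show c * ξ i * (c * ξ j) / (c * ‖ξ‖) ^ 2 = (c ^ 2 * (ξ i * ξ j)) / (c ^ 2 * ‖ξ‖ ^ 2) by ring,
    mul_div_mul_left _ _ (by positivity)]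
  ring

/-- A jointly measurable representative of the derivatives of the Oseen kernel. -/
def gradOseenRep {n : ℕ} (k i j : Fin n) (z : ℝ × Rn n) : ℝ :=
  (1 / (2 * (Real.pi : ℂ)) ^ n * (Complex.I *
    gaussFourier (fun ξ => ξ k * leraySymbol i j ξ) z.1 z.2)).re

theorem measurable_gradOseenRep {n : ℕ} (k i j : Fin n) :
    Measurable (gradOseenRep k i j) := by
  have h := measurable_gaussFourier (n := n) (p := fun ξ => ξ k * leraySymbol i j ξ)
    (Measurable.mul (by fun_prop) (measurable_leraySymbol i j))
  exact Complex.measurable_re.comp ((h.const_mul _).const_mul _)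

theorem enorm_gradOseenRep_le {n : ℕ} (k i j : Fin n) (t : ℝ) (x : Rn n) :
    ‖gradOseenRep k i j (t, x)‖ₑ ≤ ‖gaussFourier (fun ξ => ξ k * leraySymbol i j ξ) t x‖ₑ := by
  rw [← ofReal_norm, ← ofReal_norm]
  refine ENNReal.ofReal_le_ofReal ?_
  refine (Complex.abs_re_le_norm _).trans ?_
  rw [norm_mul, norm_mul, Complex.norm_I, one_mul]
  refine mul_le_of_le_one_left (norm_nonneg _) ?_
  rw [norm_div, norm_one, norm_pow, norm_mul, Complex.norm_ofNat, Complex.norm_real,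
    Real.norm_of_nonneg Real.pi_pos.le]
  refine div_le_one_of_le₀ (one_le_pow₀ ?_) (by positivity)
  linarith [Real.pi_gt_three]

/-- The symbol ξ_k (δ_{ij} - ξ_i ξ_j/|ξ|²) is homogeneous of degree one, so both bounds reduce by
scaling to t = 1. There the L¹ norm is finite and the supremum is at most the integral of the
modulus. -/
theorem exists_gradOseenRep_bounds (n : ℕ) : ∃ C : ℝ≥0, ∀ (k i j : Fin n) (t : ℝ), 0 < t →
    (∀ x : Rn n, ‖gradOseenRep k i j (t, x)‖ₑ ≤
      C * ENNReal.ofReal t ^ (-((n + 1 : ℝ) / 2))) ∧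
    ∫⁻ x : Rn n, ‖gradOseenRep k i j (t, x)‖ₑ ≤ C * ENNReal.ofReal t ^ (-(1 / 2 : ℝ)) := by
  set A : ℝ≥0∞ := ∑ k : Fin n, ∑ i : Fin n, ∑ j : Fin n,
    ∫⁻ x, ‖gaussFourier (fun ξ : Rn n => ξ k * leraySymbol i j ξ) 1 x‖ₑ with hA
  have hAtop : A ≠ ∞ := by
    rw [hA]
    simp only [ne_eq, ENNReal.sum_eq_top, not_exists, not_and]
    rintro k - i - j -
    exact (lintegral_gaussFourier_leray_lt_top k i j).ne
  set S : ℝ := ∫ ξ : Rn n, 2 * (‖ξ‖ ^ 1 * Real.exp (-(1 * ‖ξ‖ ^ 2))) with hS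
  have hsup : ∀ (k i j : Fin n) (x : Rn n),
      ‖gaussFourier (fun ξ : Rn n => ξ k * leraySymbol i j ξ) 1 x‖ ≤ S := by
    intro k i j x
    refine norm_integral_le_of_norm_le ((integrable_pow_mul_gaussian n 1 one_pos).const_mul 2)
      (Filter.Eventually.of_forall fun ξ => ?_)
    rw [norm_mul, norm_cexp_phase, Complex.norm_real, Real.norm_eq_abs, abs_mul]
    have := mul_le_mul (abs_coord_le ξ k) (abs_leraySymbol_le i j ξ) (abs_nonneg _) (norm_nonneg _)
    nlinarith [Real.exp_pos (-(1 * ‖ξ‖ ^ 2))]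
  refine ⟨A.toNNReal + S.toNNReal, fun k i j t ht => ⟨fun x => ?_, ?_⟩⟩
  · refine (enorm_gradOseenRep_le k i j t x).trans ?_
    rw [gaussFourier_scale (leraySymbol_smul k i j) ht x, enorm_mul, mul_comm]
    refine mul_le_mul' ?_ (le_of_eq ?_)
    · rw [← ofReal_norm]
      refine (ENNReal.ofReal_le_ofReal (hsup k i j _)).trans ?_
      push_cast
      exact le_add_self
    · rw [← ofReal_norm, Complex.norm_real, Real.norm_of_nonneg (by positivity),
        ENNReal.ofReal_rpow_of_pos ht, Real.sqrt_eq_rpow, ← Real.rpow_neg ht.le,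
        ← Real.rpow_natCast, ← Real.rpow_mul ht.le]
      congr 2
      push_cast
      ring
  · refine (lintegral_mono fun x => enorm_gradOseenRep_le k i j t x).trans ?_
    rw [lintegral_gaussFourier (p := fun ξ => ξ k * leraySymbol i j ξ) (leraySymbol_smul k i j)
      (Measurable.mul (by fun_prop) (measurable_leraySymbol i j)) ht, mul_comm]
    refine mul_le_mul' ?_ (le_of_eq ?_)
    · have : A ≤ ((A.toNNReal + S.toNNReal : ℝ≥0) : ℝ≥0∞) := by
        push_cast
        rw [ENNReal.coe_toNNReal hAtop]
        exact le_self_add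
      refine le_trans ?_ this
      rw [hA]
      refine le_trans ?_ (Finset.single_le_sum (fun _ _ => zero_le) (Finset.mem_univ k))
      refine le_trans ?_ (Finset.single_le_sum (fun _ _ => zero_le) (Finset.mem_univ i))
      exact Finset.single_le_sum (f := fun j => ∫⁻ x, ‖gaussFourier (fun ξ : Rn n => ξ k *
        leraySymbol i j ξ) 1 x‖ₑ) (fun _ _ => zero_le) (Finset.mem_univ j)
    · rw [ENNReal.ofReal_rpow_of_pos ht, Real.sqrt_eq_rpow, ← Real.rpow_neg ht.le, pow_one]

/-- In dimension one the Oseen kernel vanishes. -/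
theorem gradOseen_dim_one (k i j : Fin 1) (t : ℝ) (x : Rn 1) : gradOseen k i j t x = 0 := by
  have h1 : oseenKernel i j t = fun _ : Rn 1 => (0 : ℝ) := by
    ext y
    have : oseenIntegral i j t y = 0 := by
      unfold oseenIntegral
      rw [integral_eq_zero_of_ae, mul_zero]
      have h0 : ∀ᵐ ξ : Rn 1, ξ ≠ 0 := by
        rw [ae_iff]
        simp
      filter_upwards [h0] with ξ hξ
      have hi : i = 0 := Subsingleton.elim _ _
      have hj : j = 0 := Subsingleton.elim _ _
      subst hi hj
      have h2 : ‖ξ‖ ^ 2 = ξ 0 * ξ 0 := by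
        rw [EuclideanSpace.norm_sq_eq]
        simp [sq]
      have h3 : ξ 0 * ξ 0 ≠ 0 := by
        rw [← h2]
        exact pow_ne_zero 2 (norm_ne_zero_iff.2 hξ)
      simp only [if_true, h2, div_self h3, sub_self]
      simp
    simp [oseenKernel, this]
  simp [gradOseen, h1]

/-! ### Convolution estimates -/

section Convolution

variable {G : Type*} [AddCommGroup G] [MeasurableSpace G] [MeasurableAdd₂ G] [MeasurableNeg G]
  {μ : Measure G} [SFinite μ] [μ.IsAddLeftInvariant] [μ.IsNegInvariant]
  {K φ : G → ℝ≥0∞} {η : ℝ} {N : ℝ≥0∞}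

/-- Young's inequality for an integrable kernel, in terms of integrals over sets. -/
theorem setLIntegral_conv_le_lintegral_mul (hK : Measurable K) (hφ : Measurable φ)
    (hN : ∀ F, MeasurableSet F → μ F ≠ ∞ → ∫⁻ y in F, φ y ∂μ ≤ N * μ F ^ (1 - η))
    {E : Set G} (hE : MeasurableSet E) (hEt : μ E ≠ ∞) :
    ∫⁻ x in E, ∫⁻ y, K (x - y) * φ y ∂μ ∂μ ≤ (∫⁻ z, K z ∂μ) * (N * μ E ^ (1 - η)) := by
  have h1 : ∀ x, ∫⁻ y, K (x - y) * φ y ∂μ = ∫⁻ z, K z * φ (x - z) ∂μ := by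
    intro x
    rw [← lintegral_sub_left_eq_self (fun y => K (x - y) * φ y) x]
    simp
  simp only [h1]
  rw [lintegral_lintegral_swap (by fun_prop), ← lintegral_mul_const _ hK]
  refine lintegral_mono fun z => ?_
  rw [lintegral_const_mul _ (by fun_prop)]
  gcongr
  -- The shift is moved onto the set, which keeps its measure, so the hypothesis on φ applies
  -- uniformly in z.
  have h2 : ∫⁻ x in E, φ (x - z) ∂μ = ∫⁻ y in (fun y => y + z) ⁻¹' E, φ y ∂μ := by
    rw [← lintegral_indicator hE, ← lintegral_indicator ((measurable_add_const z) hE),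
      ← lintegral_add_right_eq_self _ z]
    refine lintegral_congr fun y => ?_
    by_cases h : y + z ∈ E
    · rw [indicator_of_mem h, indicator_of_mem (show y ∈ (fun y => y + z) ⁻¹' E from h),
        add_sub_cancel_right]
    · rw [indicator_of_notMem h, indicator_of_notMem (show y ∉ (fun y => y + z) ⁻¹' E from h)]
  have h3 : μ ((fun y => y + z) ⁻¹' E) = μ E := measure_preimage_add_right μ z E
  rw [h2, ← h3]
  exact hN _ ((measurable_add_const z) hE) (by rwa [h3])

/-- A pointwise bound for the convolution with a bounded kernel of decaying distribution. -/
theorem conv_le_of_measure_lt_le (hK : Measurable K) (hφ : Measurable φ)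
    (hN : ∀ F, MeasurableSet F → μ F ≠ ∞ → ∫⁻ y in F, φ y ∂μ ≤ N * μ F ^ (1 - η))
    {R κ : ℝ} (hR : 0 ≤ R) (hκ : κ < 1) (hKR : ∀ x, K x ≤ ENNReal.ofReal R) {D : ℝ≥0∞}
    (hKt : ∀ y : ℝ, 0 < y → μ {x | ENNReal.ofReal y < K x} ≠ ∞)
    (hD : ∀ y : ℝ, 0 < y → μ {x | ENNReal.ofReal y < K x} ^ (1 - η) ≤
      D * ENNReal.ofReal y ^ (-κ)) (x : G) :
    ∫⁻ y, K (x - y) * φ y ∂μ ≤ N * D * ENNReal.ofReal (R ^ (1 - κ) / (1 - κ)) := by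
  have hKx : Measurable fun y => K (x - y) := by fun_prop
  -- With φ absorbed into the measure, the layer cake in K only needs ∫ φ over superlevel sets of K,
  -- and this is what `hN` controls.
  have h1 : ∫⁻ y, K (x - y) * φ y ∂μ = ∫⁻ y, K (x - y) ∂(μ.withDensity φ) := by
    rw [lintegral_withDensity_eq_lintegral_mul _ hφ hKx]
    exact lintegral_congr fun y => mul_comm _ _
  rw [h1]
  refine lintegral_le_of_measure_lt_le hKx hR hκ (fun y => hKR _) fun y hy => ?_
  have hm : MeasurableSet {z | ENNReal.ofReal y < K (x - z)} :=
    measurableSet_lt measurable_const hKx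
  have h2 : μ {z | ENNReal.ofReal y < K (x - z)} = μ {z | ENNReal.ofReal y < K z} :=
    (Measure.measurePreserving_sub_left μ x).measure_preimage
      (measurableSet_lt measurable_const hK).nullMeasurableSet
  rw [withDensity_apply _ hm]
  refine (hN _ hm (by rw [h2]; exact hKt y hy)).trans ?_
  rw [h2, mul_assoc]
  gcongr
  exact hD y hy

theorem le_of_sq_eq_mul {q X Y Z : ℝ≥0∞} (hX : q ≤ X) (hY : q ≤ Y) (h : X * Y = Z ^ 2) :
    q ≤ Z := by
  have h1 : q ^ 2 ≤ Z ^ 2 := by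
    rw [← h, sq]
    exact mul_le_mul' hX hY
  exact (ENNReal.pow_le_pow_left_iff (two_ne_zero)).1 h1

/-- The convolution of a kernel in `L¹ ∩ L^∞` with a function in weak `L^{1/(2θ)}` belongs to weak
`L^{1/θ}`. -/
theorem exists_setLIntegral_conv_le (θ : ℝ) (hθ0 : 0 ≤ θ) (hθ : θ < 1 / 2) :
    ∃ c : ℝ≥0, ∀ (K φ : G → ℝ≥0∞) (N a R : ℝ≥0∞), a ≠ ∞ → R ≠ ∞ → Measurable K → Measurable φ →
      (∀ F, MeasurableSet F → μ F ≠ ∞ → ∫⁻ y in F, φ y ∂μ ≤ N * μ F ^ (1 - 2 * θ)) →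
      ∫⁻ z, K z ∂μ ≤ a → (∀ x, K x ≤ R) →
      ∀ E : Set G, MeasurableSet E → μ E ≠ ∞ →
      ∫⁻ x in E, ∫⁻ y, K (x - y) * φ y ∂μ ∂μ ≤
        c * (a ^ (1 - θ) * R ^ θ) * N * μ E ^ (1 - θ) := by
  rcases hθ0.eq_or_lt with rfl | hθ0
  · refine ⟨1, fun K φ N a R _ _ hK hφ hN ha hR E hE hEt => ?_⟩
    refine (setLIntegral_conv_le_lintegral_mul hK hφ hN hE hEt).trans ?_
    simp only [mul_zero, sub_zero, ENNReal.rpow_one, ENNReal.rpow_zero, mul_one, ENNReal.coe_one,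
      one_mul, ← mul_assoc]
    gcongr
  · set b : ℝ≥0∞ := ENNReal.ofReal (2 * θ)⁻¹ with hb
    refine ⟨(b ^ (1 / 2 : ℝ)).toNNReal, fun K φ N a R hat hRt hK hφ hN ha hR E hE hEt => ?_⟩
    rw [ENNReal.coe_toNNReal (by simp [hb])]
    -- `h1` uses the L¹ norm of the kernel, and `h3` adds its supremum and costs a full factor |E|.
    -- The geometric mean of the two has exactly the required powers of a, R and |E|.
    have h1 : ∫⁻ x in E, ∫⁻ y, K (x - y) * φ y ∂μ ∂μ ≤ a * (N * μ E ^ (1 - 2 * θ)) :=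
      (setLIntegral_conv_le_lintegral_mul hK hφ hN hE hEt).trans (by gcongr)
    have hmarkov : ∀ y : ℝ, 0 < y → μ {x | ENNReal.ofReal y < K x} ≤ a / ENNReal.ofReal y := by
      intro y hy
      refine (measure_mono (t := {x | ENNReal.ofReal y ≤ K x}) fun x hx => le_of_lt
        (show ENNReal.ofReal y < K x from hx)).trans
        ((meas_ge_le_lintegral_div hK.aemeasurable (ENNReal.ofReal_pos.2 hy).ne'
          ENNReal.ofReal_ne_top).trans ?_)
      gcongr
    have h2 : ∀ x, ∫⁻ y, K (x - y) * φ y ∂μ ≤ N * a ^ (1 - 2 * θ) * (R ^ (2 * θ) * b) := by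
      intro x
      refine (conv_le_of_measure_lt_le (κ := 1 - 2 * θ) (R := R.toReal) (D := a ^ (1 - 2 * θ))
        hK hφ hN ENNReal.toReal_nonneg (by linarith)
        (fun x => by rw [ENNReal.ofReal_toReal hRt]; exact hR x) ?_ ?_ x).trans ?_
      · intro y hy
        refine ((hmarkov y hy).trans_lt (ENNReal.div_lt_top hat (by simpa using hy))).ne
      · intro y hy
        refine (ENNReal.rpow_le_rpow (hmarkov y hy) (by linarith)).trans_eq ?_
        rw [ENNReal.div_rpow_of_nonneg _ _ (by linarith), ENNReal.rpow_neg, div_eq_mul_inv]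
      · rw [sub_sub_cancel, div_eq_mul_inv, ENNReal.ofReal_mul (by positivity),
          ← ENNReal.ofReal_rpow_of_nonneg ENNReal.toReal_nonneg (by linarith),
          ENNReal.ofReal_toReal hRt]
    have h3 : ∫⁻ x in E, ∫⁻ y, K (x - y) * φ y ∂μ ∂μ ≤
        N * a ^ (1 - 2 * θ) * (R ^ (2 * θ) * b) * μ E := by
      rw [← setLIntegral_const]
      exact lintegral_mono h2
    refine le_of_sq_eq_mul h1 h3 ?_
    have hpow : ∀ z : ℝ≥0∞, z * z ^ (1 - 2 * θ) = (z ^ (1 - θ)) ^ 2 := by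
      intro z
      rw [← ENNReal.rpow_natCast, ← ENNReal.rpow_mul]
      nth_rewrite 1 [← ENNReal.rpow_one z]
      rw [← ENNReal.rpow_add_of_nonneg _ _ zero_le_one (by linarith)]
      congr 1
      push_cast
      ring
    have hb2 : (b ^ (1 / 2 : ℝ)) ^ 2 = b := by
      rw [← ENNReal.rpow_natCast, ← ENNReal.rpow_mul]
      norm_num
    have hR2 : (R ^ θ) ^ 2 = R ^ (2 * θ) := by
      rw [← ENNReal.rpow_natCast, ← ENNReal.rpow_mul, mul_comm]
      norm_num
    calc a * (N * μ E ^ (1 - 2 * θ)) * (N * a ^ (1 - 2 * θ) * (R ^ (2 * θ) * b) * μ E)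
        = b * (a * a ^ (1 - 2 * θ)) * R ^ (2 * θ) * N ^ 2 * (μ E * μ E ^ (1 - 2 * θ)) := by ring
      _ = (b ^ (1 / 2 : ℝ)) ^ 2 * (a ^ (1 - θ)) ^ 2 * (R ^ θ) ^ 2 * N ^ 2 *
            (μ E ^ (1 - θ)) ^ 2 := by rw [hpow, hpow, hb2, hR2]
      _ = _ := by ring

end Convolution

/-! ### Fractional integration in time. -/

/-- The kernel `s^{-(1-β)}` on the positive half line. -/
def timeKernel (β : ℝ) (s : ℝ) : ℝ≥0∞ :=
  (Ioi (0 : ℝ)).indicator (fun s => ENNReal.ofReal s ^ (-(1 - β))) s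

theorem measurable_timeKernel (β : ℝ) : Measurable (timeKernel β) :=
  Measurable.indicator (by fun_prop) measurableSet_Ioi

/-- The Hardy–Littlewood–Sobolev inequality in weak spaces, in dimension one. -/
theorem exists_setLIntegral_timeKernel_le (β : ℝ) (hβ0 : 0 < β) (hβ : β < 1 / 2) :
    ∃ c : ℝ≥0, ∀ (φ : ℝ → ℝ≥0∞) (N : ℝ≥0∞), Measurable φ →
      (∀ F : Set ℝ, MeasurableSet F → volume F ≠ ∞ →
        ∫⁻ y in F, φ y ≤ N * volume F ^ (1 - 2 * β)) →
      ∀ E : Set ℝ, MeasurableSet E → volume E ≠ ∞ →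
      ∫⁻ t in E, ∫⁻ s, timeKernel β (t - s) * φ s ≤ c * N * volume E ^ (1 - β) := by
  refine ⟨(β⁻¹).toNNReal + ((1 - β) / β).toNNReal, fun φ N hφ hN E hE hEt => ?_⟩
  by_cases hE0 : volume E = 0
  · rw [Measure.restrict_eq_zero.2 hE0]
    simp
  -- The kernel is cut at s = |E|. The near part is integrable with norm R^β/β; the tail is handled
  -- by the pointwise bound, which gives N R^{-β}(1-β)/β. Both contribute a multiple of N|E|^{1-β}.
  set R := (volume E).toReal with hRdef
  have hR : 0 < R := ENNReal.toReal_pos hE0 hEt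
  have hER : volume E = ENNReal.ofReal R := (ENNReal.ofReal_toReal hEt).symm
  set k0 : ℝ → ℝ≥0∞ := (Ioo 0 R).indicator (fun s => ENNReal.ofReal s ^ (-(1 - β))) with hk0
  set k1 : ℝ → ℝ≥0∞ := (Ici R).indicator (fun s => ENNReal.ofReal s ^ (-(1 - β))) with hk1
  have hk0m : Measurable k0 := Measurable.indicator (by fun_prop) measurableSet_Ioo
  have hk1m : Measurable k1 := Measurable.indicator (by fun_prop) measurableSet_Ici
  have hk : ∀ s, timeKernel β s = k0 s + k1 s := by
    intro s
    simp only [timeKernel, hk0, hk1, indicator, mem_Ioi, mem_Ioo, mem_Ici]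
    by_cases h0 : 0 < s
    · by_cases h1 : s < R
      · simp [h0, h1, not_le.2 h1]
      · simp [h0, h1, not_lt.1 h1]
    · have : ¬ R ≤ s := by intro h; linarith
      simp [h0, this]
  have hsplit : ∫⁻ t in E, ∫⁻ s, timeKernel β (t - s) * φ s =
      (∫⁻ t in E, ∫⁻ s, k0 (t - s) * φ s) + ∫⁻ t in E, ∫⁻ s, k1 (t - s) * φ s := by
    rw [← lintegral_add_left]
    · refine lintegral_congr fun t => ?_
      rw [← lintegral_add_left (by fun_prop)]
      refine lintegral_congr fun s => ?_
      rw [hk, add_mul]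
    · exact Measurable.lintegral_prod_right' (f := fun z : ℝ × ℝ => k0 (z.1 - z.2) * φ z.2)
        (by fun_prop)
  have hk0int : ∫⁻ z, k0 z = ENNReal.ofReal (R ^ β / β) := by
    rw [hk0, lintegral_indicator measurableSet_Ioo, lintegral_rpow_neg (by linarith) hR.le,
      sub_sub_cancel]
  have h0 : ∫⁻ t in E, ∫⁻ s, k0 (t - s) * φ s ≤
      ((β⁻¹).toNNReal : ℝ≥0∞) * N * volume E ^ (1 - β) := by
    refine (setLIntegral_conv_le_lintegral_mul hk0m hφ hN hE hEt).trans_eq ?_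
    rw [hk0int, hER, div_eq_mul_inv, ENNReal.ofReal_mul (by positivity),
      ← ENNReal.ofReal_rpow_of_pos hR, show 1 - β = β + (1 - 2 * β) by ring,
      ENNReal.rpow_add _ _ (by simpa using hR) (by simp)]
    change _ * ENNReal.ofReal β⁻¹ * _ = ENNReal.ofReal β⁻¹ * _ * _
    ring
  -- Superlevel sets of the tail have measure at most y^{-1/(1-β)}; raised to the power 1-2β this
  -- decays like y^{-κ}.
  set κ := (1 - 2 * β) / (1 - β) with hκ
  have hκ1 : 1 - κ = β / (1 - β) := by
    rw [hκ]
    field_simp [show (1 - β) ≠ 0 by linarith]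
    ring
  have h1 : ∀ t, ∫⁻ s, k1 (t - s) * φ s ≤
      N * 1 * ENNReal.ofReal ((R ^ (-(1 - β))) ^ (1 - κ) / (1 - κ)) := by
    have hset : ∀ y : ℝ, 0 < y →
        volume {s | ENNReal.ofReal y < k1 s} ≤ ENNReal.ofReal (y ^ (-(1 - β)⁻¹)) := by
      intro y hy
      have hvol : volume (Icc 0 (y ^ (-(1 - β)⁻¹))) = ENNReal.ofReal (y ^ (-(1 - β)⁻¹)) := by
        rw [Real.volume_Icc, sub_zero]
      rw [← hvol]
      refine measure_mono fun s hs => ?_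
      replace hs : ENNReal.ofReal y < k1 s := hs
      have hs1 : s ∈ Ici R := by
        by_contra hc
        rw [hk1, indicator_of_notMem hc] at hs
        exact not_lt_zero hs
      have hs0 : 0 < s := hR.trans_le hs1
      rw [hk1, indicator_of_mem hs1, ENNReal.ofReal_rpow_of_pos hs0,
        ENNReal.ofReal_lt_ofReal_iff (by positivity)] at hs
      refine ⟨hs0.le, ?_⟩
      have h2 := Real.rpow_le_rpow_of_nonpos hy hs.le
        (z := -(1 - β)⁻¹) (by rw [neg_nonpos, inv_nonneg]; linarith)
      rwa [← Real.rpow_mul hs0.le, neg_mul_neg, mul_inv_cancel₀ (by linarith), Real.rpow_one] at h2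
    refine conv_le_of_measure_lt_le hk1m hφ hN (by positivity) ?_ ?_ ?_ ?_
    · have : 0 < 1 - κ := by rw [hκ1]; exact div_pos hβ0 (by linarith)
      linarith
    · intro s
      by_cases hs : s ∈ Ici R
      · have hs0 : 0 < s := hR.trans_le hs
        rw [hk1, indicator_of_mem hs, ENNReal.ofReal_rpow_of_pos hs0]
        exact ENNReal.ofReal_le_ofReal (Real.rpow_le_rpow_of_nonpos hR hs (by linarith))
      · rw [hk1, indicator_of_notMem hs]
        exact zero_le
    · intro y hy
      exact ((hset y hy).trans_lt ENNReal.ofReal_lt_top).ne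
    · intro y hy
      refine (ENNReal.rpow_le_rpow (hset y hy) (by linarith)).trans_eq ?_
      rw [one_mul, ENNReal.ofReal_rpow_of_pos hy, ENNReal.ofReal_rpow_of_pos (by positivity),
        ← Real.rpow_mul hy.le, hκ]
      congr 2
      ring
  have h2 : ∫⁻ t in E, ∫⁻ s, k1 (t - s) * φ s ≤
      (((1 - β) / β).toNNReal : ℝ≥0∞) * N * volume E ^ (1 - β) := by
    refine (lintegral_mono h1).trans_eq ?_
    rw [setLIntegral_const, hER, hκ1, ← Real.rpow_mul hR.le, neg_mul,
      mul_div_cancel₀ _ (show (1 - β) ≠ 0 by linarith), div_div_eq_mul_div,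
      mul_div_assoc, ENNReal.ofReal_mul (by positivity), ← ENNReal.ofReal_rpow_of_pos hR,
      show 1 - β = -β + 1 by ring, ENNReal.rpow_add _ _ (by simpa using hR) (by simp),
      ENNReal.rpow_one]
    change _ * (_ * ENNReal.ofReal _) * _ = ENNReal.ofReal _ * _ * _
    ring
  rw [hsplit]
  refine (add_le_add h0 h2).trans_eq ?_
  push_cast
  ring

/-! ### The spatial bilinear estimate -/

/-- The sum of the absolute values of all entries of the kernel. -/
def kernelAbs (n : ℕ) (z : ℝ × Rn n) : ℝ≥0∞ := ∑ i, ∑ j, ∑ k, ‖gradOseenRep k i j z‖ₑ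

theorem measurable_kernelAbs (n : ℕ) : Measurable (kernelAbs n) := by
  have := fun k i j => (measurable_gradOseenRep (n := n) k i j).enorm
  unfold kernelAbs
  fun_prop

theorem exists_kernelAbs_bounds (n : ℕ) : ∃ C : ℝ≥0, ∀ t : ℝ, 0 < t →
    (∀ x : Rn n, kernelAbs n (t, x) ≤ C * ENNReal.ofReal t ^ (-((n + 1 : ℝ) / 2))) ∧
    ∫⁻ x : Rn n, kernelAbs n (t, x) ≤ C * ENNReal.ofReal t ^ (-(1 / 2 : ℝ)) := by
  obtain ⟨C, hC⟩ := exists_gradOseenRep_bounds n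
  refine ⟨n * (n * (n * C)), fun t ht => ⟨fun x => ?_, ?_⟩⟩
  · calc kernelAbs n (t, x) ≤ ∑ _i : Fin n, ∑ _j : Fin n, ∑ _k : Fin n,
          C * ENNReal.ofReal t ^ (-((n + 1 : ℝ) / 2)) := by
          unfold kernelAbs
          gcongr with i _ j _ k _
          exact (hC k i j t ht).1 x
      _ = _ := by
          simp
          ring
  · have hm : ∀ k i j : Fin n, Measurable fun x : Rn n => ‖gradOseenRep k i j (t, x)‖ₑ :=
      fun k i j => ((measurable_gradOseenRep k i j).comp
        (measurable_const.prodMk measurable_id)).enorm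
    calc ∫⁻ x : Rn n, kernelAbs n (t, x)
        = ∑ i : Fin n, ∑ j : Fin n, ∑ k : Fin n, ∫⁻ x, ‖gradOseenRep k i j (t, x)‖ₑ := by
          unfold kernelAbs
          rw [lintegral_finsetSum _ (by fun_prop)]
          refine Finset.sum_congr rfl fun i _ => ?_
          rw [lintegral_finsetSum _ (by fun_prop)]
          refine Finset.sum_congr rfl fun j _ => ?_
          rw [lintegral_finsetSum _ (by fun_prop)]
      _ ≤ ∑ _i : Fin n, ∑ _j : Fin n, ∑ _k : Fin n,
          C * ENNReal.ofReal t ^ (-(1 / 2 : ℝ)) := by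
          gcongr with i _ j _ k _
          exact (hC k i j t ht).2
      _ = _ := by
          simp
          ring

/-- Weak Hölder gives the product exponent 2θ, and convolution with a kernel in L¹ ∩ L^∞ brings it
back to θ. The time exponent is (1-θ)/2 + θ(n+1)/2 = 1/2 + nθ/2. -/
theorem exists_setLIntegral_kernelAbs_le (n : ℕ) (θ : ℝ) (hθ0 : 0 ≤ θ) (hθ : θ < 1 / 2) :
    ∃ C : ℝ≥0, ∀ (t : ℝ) (g h : Rn n → ℝ≥0∞), 0 < t → Measurable g → Measurable h →
      ∀ E : Set (Rn n), MeasurableSet E → volume E ≠ ∞ →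
      ∫⁻ x in E, ∫⁻ y, kernelAbs n (t, x - y) * (g y * h y) ≤
        C * ENNReal.ofReal t ^ (-(1 / 2 + n * θ / 2)) *
          (weakNorm volume θ g * weakNorm volume θ h) * volume E ^ (1 - θ) := by
  obtain ⟨C, hC⟩ := exists_kernelAbs_bounds n
  obtain ⟨c, hc⟩ := exists_setLIntegral_conv_le (μ := (volume : Measure (Rn n))) θ hθ0 hθ
  refine ⟨c * C * (1 - 2 * θ)⁻¹.toNNReal, fun t g h ht hg hh E hE hEt => ?_⟩
  have ht0 : ENNReal.ofReal t ≠ 0 := by simpa using ht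
  have hfin : ∀ a : ℝ, ENNReal.ofReal t ^ a ≠ ∞ := fun a => by
    rw [ENNReal.ofReal_rpow_of_pos ht]
    exact ENNReal.ofReal_ne_top
  have hK : Measurable fun z : Rn n => kernelAbs n (t, z) :=
    (measurable_kernelAbs n).comp (measurable_const.prodMk measurable_id)
  have h1 := hc (fun z => kernelAbs n (t, z)) (fun y => g y * h y)
    (ENNReal.ofReal (1 - 2 * θ)⁻¹ * weakNorm volume θ g * weakNorm volume θ h)
    (C * ENNReal.ofReal t ^ (-(1 / 2 : ℝ))) (C * ENNReal.ofReal t ^ (-((n + 1 : ℝ) / 2)))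
    (ENNReal.mul_ne_top ENNReal.coe_ne_top (hfin _))
    (ENNReal.mul_ne_top ENNReal.coe_ne_top (hfin _)) hK (hg.mul hh)
    (fun F _ hF => WeakBound.setLIntegral_mul_le hθ0 hθ hg hh (weakBound_weakNorm hθ0)
      (weakBound_weakNorm hθ0) hF) (hC t ht).2 (hC t ht).1 E hE hEt
  refine h1.trans_eq ?_
  rw [ENNReal.mul_rpow_of_nonneg _ _ (by linarith), ENNReal.mul_rpow_of_nonneg _ _ hθ0,
    ← ENNReal.rpow_mul, ← ENNReal.rpow_mul]
  have h2 : (C : ℝ≥0∞) ^ (1 - θ) * (C : ℝ≥0∞) ^ θ = C := by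
    rw [← ENNReal.rpow_add_of_nonneg _ _ (by linarith) hθ0]
    simp
  have h3 : ENNReal.ofReal t ^ (-(1 / 2) * (1 - θ)) *
      ENNReal.ofReal t ^ (-((n + 1 : ℝ) / 2) * θ) =
      ENNReal.ofReal t ^ (-(1 / 2 + n * θ / 2)) := by
    rw [← ENNReal.rpow_add _ _ ht0 ENNReal.ofReal_ne_top]
    congr 1
    ring
  rw [← h3]
  push_cast
  nth_rewrite 3 [← h2]
  change _ = _ * ENNReal.ofReal (1 - 2 * θ)⁻¹ * _ * _ * _
  ring

/-! ### Uniqueness for a singular Volterra inequality -/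

section Vanishing

variable {X : Type*} [MeasurableSpace X] {μ : Measure X} {β : ℝ} {g : X → ℝ≥0∞} {M : ℝ≥0∞}

/-- The set where g is infinite lies in every superlevel set, so positive measure would make every k
times a fixed positive number at most M. -/
theorem WeakBound.ae_lt_top (hβ : 0 ≤ β) (h : WeakBound μ β g M) (hM : M ≠ ∞) :
    ∀ᵐ x ∂μ, g x < ∞ := by
  rw [ae_iff]
  simp only [not_lt, top_le_iff]
  by_contra hc
  have hpos : posRpow β (μ {x | g x = ∞}) ≠ 0 := by
    rw [posRpow, if_neg hc]
    simp [ENNReal.rpow_eq_zero_iff, hc, not_lt.2 hβ]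
  have h1 : ∀ k : ℕ, (k : ℝ≥0∞) * posRpow β (μ {x | g x = ∞}) ≤ M := by
    intro k
    refine le_trans ?_ (h k)
    gcongr
    refine posRpow_mono hβ (measure_mono fun x hx => ?_)
    change (k : ℝ≥0∞) < g x
    rw [show g x = ∞ from hx]
    exact ENNReal.natCast_lt_top k
  generalize posRpow β (μ {x | g x = ∞}) = P at hpos h1
  have h2 : ∞ * P ≤ M := by
    rw [← ENNReal.iSup_natCast, ENNReal.iSup_mul]
    exact iSup_le h1
  rw [ENNReal.top_mul hpos] at h2
  exact hM (top_le_iff.1 h2)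

theorem weakBound_indicator_iff {A : Set X} (hA : MeasurableSet A) :
    WeakBound μ β (A.indicator g) M ↔ WeakBound (μ.restrict A) β g M := by
  have h : ∀ y, μ {x | y < A.indicator g x} = (μ.restrict A) {x | y < g x} := by
    intro y
    rw [Measure.restrict_apply' hA]
    congr 1
    ext x
    by_cases hx : x ∈ A
    · simp [hx]
    · simp [hx]
  simp only [WeakBound, h]

/-- `y λ_g(y)^β → 0` as `y → ∞`. -/
def WeakVanishing (μ : Measure X) (β : ℝ) (g : X → ℝ≥0∞) : Prop :=
  ∀ ε : ℝ≥0∞, ε ≠ 0 → ∃ Y : ℝ≥0∞, Y ≠ ∞ ∧ ∀ y, Y ≤ y → y * posRpow β (μ {x | y < g x}) ≤ ε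

theorem WeakVanishing.mono (hβ : 0 ≤ β) {g' : X → ℝ≥0∞} (h : WeakVanishing μ β g)
    (hg : ∀ᵐ x ∂μ, g' x ≤ g x) : WeakVanishing μ β g' := by
  intro ε hε
  obtain ⟨Y, hY, h1⟩ := h ε hε
  refine ⟨Y, hY, fun y hy => le_trans ?_ (h1 y hy)⟩
  gcongr
  refine posRpow_mono hβ (measure_mono_ae ?_)
  filter_upwards [hg] with x hx hxy
  exact lt_of_lt_of_le hxy hx

theorem posRpow_le_rpow (l : ℝ≥0∞) : posRpow β l ≤ l ^ β := by
  unfold posRpow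
  split_ifs
  · exact zero_le
  · exact le_rfl

/-- The weak norm of a vanishing function is uniformly small on small sets. -/
theorem WeakVanishing.exists_forall_restrict (hβ : 0 < β) (h : WeakVanishing μ β g) {ε : ℝ≥0∞}
    (hε : ε ≠ 0) :
    ∃ δ : ℝ, 0 < δ ∧ ∀ S : Set X, μ S ≤ ENNReal.ofReal δ → WeakBound (μ.restrict S) β g ε := by
  obtain ⟨Y, hY, h1⟩ := h ε hε
  -- Below the threshold Y the weak quantity is at most Y μ(S)^β, which is at most ε once μ(S) ≤
  -- (ε/Y)^{1/β}. The minimum with 1 keeps d finite, also when Y = 0.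
  set d : ℝ≥0∞ := min ((ε / Y) ^ β⁻¹) 1 with hd
  have hd0 : d ≠ 0 := by
    have : (ε / Y) ^ β⁻¹ ≠ 0 := by
      simp [ENNReal.rpow_eq_zero_iff, hε, hY, ENNReal.div_eq_zero_iff, not_lt.2 hβ.le]
    simp only [hd, ne_eq, min_eq_iff, not_or, not_and]
    exact ⟨fun h => absurd h this, fun h => absurd h one_ne_zero⟩
  have hdt : d ≠ ∞ := ne_top_of_le_ne_top ENNReal.one_ne_top (min_le_right _ _)
  refine ⟨d.toReal, ENNReal.toReal_pos hd0 hdt, fun S hS y => ?_⟩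
  rw [ENNReal.ofReal_toReal hdt] at hS
  rcases le_total Y y with hy | hy
  · refine le_trans ?_ (h1 y hy)
    gcongr
    exact posRpow_mono hβ.le (Measure.restrict_apply_le _ _)
  · have h2 : (μ.restrict S) {x | y < g x} ≤ (ε / Y) ^ β⁻¹ :=
      (measure_mono (subset_univ _)).trans (by simpa using hS.trans (min_le_left _ _))
    calc y * posRpow β ((μ.restrict S) {x | y < g x}) ≤ Y * ((ε / Y) ^ β⁻¹) ^ β := by
          gcongr
          exact (posRpow_le_rpow _).trans (ENNReal.rpow_le_rpow h2 hβ.le)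
      _ = Y * (ε / Y) := by rw [ENNReal.rpow_inv_rpow hβ.ne']
      _ ≤ ε := ENNReal.mul_div_le

/-- A vanishing function on a space of finite measure has a weak bound. -/
theorem WeakVanishing.exists_weakBound [IsFiniteMeasure μ] (hβ : 0 ≤ β)
    (h : WeakVanishing μ β g) : ∃ M : ℝ≥0∞, M ≠ ∞ ∧ WeakBound μ β g M := by
  obtain ⟨Y, hY, h1⟩ := h 1 one_ne_zero
  refine ⟨1 + Y * μ univ ^ β, ?_, fun y => ?_⟩
  · refine ENNReal.add_ne_top.2 ⟨ENNReal.one_ne_top, ENNReal.mul_ne_top hY ?_⟩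
    exact ENNReal.rpow_ne_top_of_nonneg hβ (measure_ne_top _ _)
  · rcases le_total Y y with hy | hy
    · exact (h1 y hy).trans le_self_add
    · refine le_trans ?_ le_add_self
      gcongr
      exact (posRpow_le_rpow _).trans (ENNReal.rpow_le_rpow (measure_mono (subset_univ _)) hβ)

end Vanishing

theorem rpow_neg_le_timeKernel {a β T₀ τ : ℝ} (ha : a ≤ 1 - β) (hτ : 0 < τ) (hτT : τ ≤ T₀) :
    ENNReal.ofReal τ ^ (-a) ≤ ENNReal.ofReal (T₀ ^ (1 - β - a)) * timeKernel β τ := by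
  rw [timeKernel, indicator_of_mem (show τ ∈ Ioi (0 : ℝ) from hτ)]
  have h1 : ENNReal.ofReal τ ^ (-a) =
      ENNReal.ofReal τ ^ (1 - β - a) * ENNReal.ofReal τ ^ (-(1 - β)) := by
    rw [← ENNReal.rpow_add _ _ (by simpa using hτ) ENNReal.ofReal_ne_top]
    congr 1
    ring
  rw [h1, ENNReal.ofReal_rpow_of_pos hτ (p := 1 - β - a)]
  gcongr

/-- The singular Volterra operator has a weak-type bilinear bound. -/
theorem exists_volterra_setLIntegral_le {β a T₀ : ℝ} (hβ0 : 0 < β) (hβ : β < 1 / 2)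
    (ha : a ≤ 1 - β) :
    ∃ c : ℝ≥0, ∀ (G H : ℝ → ℝ≥0∞) (A : Set ℝ) (m₁ m₂ : ℝ≥0∞), Measurable G → Measurable H →
      MeasurableSet A → A ⊆ Ioo 0 T₀ → WeakBound (volume.restrict A) β G m₁ →
      WeakBound (volume.restrict A) β H m₂ →
      ∀ E : Set ℝ, MeasurableSet E → volume E ≠ ∞ →
        ∫⁻ t in E, (Ioo 0 T₀).indicator (fun t => ∫⁻ s in Ioo 0 t ∩ A,
          ENNReal.ofReal (t - s) ^ (-a) * (G s * H s)) t ≤ c * (m₁ * m₂) * volume E ^ (1 - β) := by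
  obtain ⟨c, hc⟩ := exists_setLIntegral_timeKernel_le β hβ0 hβ
  refine ⟨(T₀ ^ (1 - β - a)).toNNReal * c * (1 - 2 * β)⁻¹.toNNReal,
    fun G H A m₁ m₂ hG hH hA hAT hm₁ hm₂ E hE hEt => ?_⟩
  have hG1 := hG.indicator hA
  have hH1 := hH.indicator hA
  have h1 := hc (fun s => A.indicator G s * A.indicator H s)
    (ENNReal.ofReal (1 - 2 * β)⁻¹ * m₁ * m₂) (hG1.mul hH1)
    (fun F _ hF => WeakBound.setLIntegral_mul_le hβ0.le hβ hG1 hH1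
      ((weakBound_indicator_iff hA).2 hm₁) ((weakBound_indicator_iff hA).2 hm₂) hF) E hE hEt
  have hm : Measurable fun t => ∫⁻ s, timeKernel β (t - s) *
      (A.indicator G s * A.indicator H s) :=
    Measurable.lintegral_prod_right' (f := fun z : ℝ × ℝ => timeKernel β (z.1 - z.2) *
      (A.indicator G z.2 * A.indicator H z.2)) (by
        have := measurable_timeKernel β
        fun_prop)
  calc ∫⁻ t in E, (Ioo 0 T₀).indicator (fun t => ∫⁻ s in Ioo 0 t ∩ A,
          ENNReal.ofReal (t - s) ^ (-a) * (G s * H s)) t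
      ≤ ∫⁻ t in E, ENNReal.ofReal (T₀ ^ (1 - β - a)) * ∫⁻ s, timeKernel β (t - s) *
          (A.indicator G s * A.indicator H s) := by
        refine lintegral_mono fun t => ?_
        by_cases ht : t ∈ Ioo 0 T₀
        · rw [indicator_of_mem ht, ← lintegral_const_mul _ (by
              have := measurable_timeKernel β
              fun_prop), ← lintegral_indicator (measurableSet_Ioo.inter hA)]
          refine lintegral_mono fun s => ?_
          by_cases hs : s ∈ Ioo 0 t ∩ A
          · rw [indicator_of_mem hs, indicator_of_mem hs.2, indicator_of_mem hs.2]
            exact (mul_le_mul' (rpow_neg_le_timeKernel (T₀ := T₀) ha (sub_pos.2 hs.1.2)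
              (by linarith [hs.1.1, ht.2])) le_rfl).trans_eq (mul_assoc _ _ _)
          · rw [indicator_of_notMem hs]
            exact zero_le
        · rw [indicator_of_notMem ht]
          exact zero_le
    _ = ENNReal.ofReal (T₀ ^ (1 - β - a)) * ∫⁻ t in E, ∫⁻ s, timeKernel β (t - s) *
          (A.indicator G s * A.indicator H s) := lintegral_const_mul _ hm
    _ ≤ ENNReal.ofReal (T₀ ^ (1 - β - a)) * (c * (ENNReal.ofReal (1 - 2 * β)⁻¹ * m₁ * m₂) *
          volume E ^ (1 - β)) := by gcongr
    _ = _ := by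
        push_cast
        change _ = ENNReal.ofReal _ * _ * ENNReal.ofReal _ * _ * _
        ring

theorem measurable_volterra {a : ℝ} {G H : ℝ → ℝ≥0∞} (hG : Measurable G) (hH : Measurable H)
    {A : Set ℝ} (hA : MeasurableSet A) :
    Measurable fun t : ℝ => ∫⁻ s in Ioo 0 t ∩ A,
      ENNReal.ofReal (t - s) ^ (-a) * (G s * H s) := by
  have hset : MeasurableSet {z : ℝ × ℝ | 0 < z.2 ∧ z.2 < z.1 ∧ z.2 ∈ A} :=
    (measurableSet_lt measurable_const measurable_snd).inter
      ((measurableSet_lt measurable_snd measurable_fst).inter (measurable_snd hA))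
  have hm : Measurable ({z : ℝ × ℝ | 0 < z.2 ∧ z.2 < z.1 ∧ z.2 ∈ A}.indicator fun z : ℝ × ℝ =>
      ENNReal.ofReal (z.1 - z.2) ^ (-a) * (G z.2 * H z.2)) :=
    Measurable.indicator (by fun_prop) hset
  have h := hm.lintegral_prod_right' (ν := volume)
  convert h using 2 with t
  rw [← lintegral_indicator (measurableSet_Ioo.inter hA)]
  refine lintegral_congr fun s => ?_
  by_cases hs : s ∈ Ioo 0 t ∩ A
  · rw [indicator_of_mem hs, indicator_of_mem
      (show (t, s) ∈ {z : ℝ × ℝ | 0 < z.2 ∧ z.2 < z.1 ∧ z.2 ∈ A} from ⟨hs.1.1, hs.1.2, hs.2⟩)]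
  · rw [indicator_of_notMem hs, indicator_of_notMem
      (show (t, s) ∉ {z : ℝ × ℝ | 0 < z.2 ∧ z.2 < z.1 ∧ z.2 ∈ A} from
        fun h => hs ⟨⟨h.1, h.2.1⟩, h.2.2⟩)]

/-- A solution of the homogeneous singular Volterra inequality with vanishing coefficient is
zero. -/
theorem ae_eq_zero_of_le_volterra {β a T₀ : ℝ} (hβ0 : 0 < β) (hβ : β < 1 / 2) (ha : a ≤ 1 - β)
    {C : ℝ≥0} {G₁ G₂ H : ℝ → ℝ≥0∞} (hG₁m : Measurable G₁) (hG₂m : Measurable G₂)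
    (hHm : Measurable H)
    (hG₁ : WeakVanishing (volume.restrict (Ioo 0 T₀)) β G₁)
    (hG₂ : WeakVanishing (volume.restrict (Ioo 0 T₀)) β G₂) {M : ℝ≥0∞} (hM : M ≠ ∞)
    (hH : WeakBound (volume.restrict (Ioo 0 T₀)) β H M)
    (hineq : ∀ᵐ t ∂(volume.restrict (Ioo 0 T₀)),
      H t ≤ C * ∫⁻ s in Ioo 0 t, ENNReal.ofReal (t - s) ^ (-a) * ((G₁ s + G₂ s) * H s)) :
    ∀ᵐ t ∂(volume.restrict (Ioo 0 T₀)), H t = 0 := by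
  obtain ⟨c, hc⟩ := exists_volterra_setLIntegral_le (T₀ := T₀) hβ0 hβ ha
  -- The sum of the two coefficients has weak bound 2(ε + ε) = 4ε, and this ε makes C·c·4ε ≤ 1/2.
  set ε : ℝ≥0∞ := (8 * (C * c + 1))⁻¹ with hε
  have hε0 : ε ≠ 0 := by
    rw [hε]
    exact ENNReal.inv_ne_zero.2 (ENNReal.mul_ne_top (by simp) (by finiteness))
  obtain ⟨δ₁, hδ₁, h₁⟩ := hG₁.exists_forall_restrict hβ0 hε0
  obtain ⟨δ₂, hδ₂, h₂⟩ := hG₂.exists_forall_restrict hβ0 hε0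
  set δ := min δ₁ δ₂ with hδ
  have hδ0 : 0 < δ := lt_min hδ₁ hδ₂
  have hG₁₂ : Measurable fun s => G₁ s + G₂ s := hG₁m.add hG₂m
  -- Induction over steps of the fixed length δ. No step shrinks, because the smallness of the
  -- coefficients depends only on the length of the interval.
  have key : ∀ N : ℕ, ∀ᵐ t ∂(volume.restrict (Ioo 0 T₀)), t < N * δ → H t = 0 := by
    intro N
    induction N with
    | zero =>
      filter_upwards [ae_restrict_mem measurableSet_Ioo] with t ht h
      simp only [Nat.cast_zero, zero_mul] at h
      exact absurd ht.1 (not_lt.2 h.le)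
    | succ N ih =>
      set S : Set ℝ := Ico (N * δ) ((N + 1) * δ) with hS
      set A : Set ℝ := S ∩ Ioo 0 T₀ with hA
      have hSm : MeasurableSet S := measurableSet_Ico
      have hAm : MeasurableSet A := hSm.inter measurableSet_Ioo
      have hAT : A ⊆ Ioo 0 T₀ := inter_subset_right
      have hSvol : (volume.restrict (Ioo 0 T₀)) S ≤ ENNReal.ofReal δ := by
        refine (Measure.restrict_apply_le _ _).trans_eq ?_
        rw [hS, Real.volume_Ico]
        congr 1
        ring
      have hrr : (volume.restrict (Ioo 0 T₀)).restrict S = volume.restrict A :=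
        Measure.restrict_restrict hSm
      have hGA : WeakBound (volume.restrict A) β (fun s => G₁ s + G₂ s) (2 * (ε + ε)) := by
        rw [← hrr]
        exact (h₁ S (hSvol.trans (ENNReal.ofReal_le_ofReal (min_le_left _ _)))).add hβ0.le
          (by linarith) (h₂ S (hSvol.trans (ENNReal.ofReal_le_ofReal (min_le_right _ _))))
      set m := weakNorm (volume.restrict A) β H with hm
      have hHA : WeakBound (volume.restrict A) β H m := weakBound_weakNorm hβ0.le
      -- Finiteness of m, from the a priori bound on H, is what lets m ≤ m/2 force m = 0.
      have hmt : m ≠ ∞ := by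
        refine ne_top_of_le_ne_top hM (weakNorm_le fun y => le_trans ?_ (hH y))
        gcongr
        exact posRpow_mono hβ0.le (Measure.restrict_mono hAT le_rfl _)
      -- By the induction hypothesis H vanishes before Nδ, so for t in the current step the memory
      -- integral only sees A.
      have hineq' : ∀ᵐ t, A.indicator H t ≤ C * (Ioo 0 T₀).indicator (fun t => ∫⁻ s in Ioo 0 t ∩ A,
          ENNReal.ofReal (t - s) ^ (-a) * ((G₁ s + G₂ s) * H s)) t := by
        have h3 := (ae_restrict_iff' measurableSet_Ioo).1 hineq
        have h4 := (ae_restrict_iff' measurableSet_Ioo).1 ih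
        filter_upwards [h3] with t ht
        by_cases htA : t ∈ A
        · rw [indicator_of_mem htA, indicator_of_mem (hAT htA)]
          refine (ht (hAT htA)).trans (mul_le_mul' le_rfl ?_)
          rw [← lintegral_indicator measurableSet_Ioo,
            ← lintegral_indicator (measurableSet_Ioo.inter hAm)]
          refine lintegral_mono_ae ?_
          filter_upwards [h4] with s hs
          by_cases hst : s ∈ Ioo 0 t
          · have hsT : s ∈ Ioo 0 T₀ := ⟨hst.1, hst.2.trans htA.2.2⟩
            by_cases hsA : s ∈ A
            · rw [indicator_of_mem hst, indicator_of_mem (mem_inter hst hsA)]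
            · have : s < N * δ := by
                by_contra hcon
                exact hsA ⟨⟨not_lt.1 hcon, hst.2.trans htA.1.2⟩, hsT⟩
              rw [indicator_of_mem hst, hs hsT this]
              simp
          · rw [indicator_of_notMem hst]
            exact zero_le
        · rw [indicator_of_notMem htA]
          exact zero_le
      have hbound : WeakBound volume β (A.indicator H) (C * (c * (2 * (ε + ε) * m))) := by
        refine weakBound_of_setLIntegral_le hβ0.le (hHm.indicator hAm) fun E hE hEt => ?_
        refine (lintegral_mono_ae (ae_restrict_of_ae hineq')).trans ?_
        rw [lintegral_const_mul _ ((measurable_volterra hG₁₂ hHm hAm).indicator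
          measurableSet_Ioo), mul_assoc (C : ℝ≥0∞)]
        gcongr
        exact hc _ H A _ m hG₁₂ hHm hAm hAT hGA hHA E hE hEt
      have hm2 : m ≤ m / 2 := by
        refine (weakNorm_le ((weakBound_indicator_iff hAm).1 hbound)).trans ?_
        have h5 : 8 * (C * c + 1 : ℝ≥0∞) * ε = 1 := by
          rw [hε, ENNReal.mul_inv_cancel (by simp) (by finiteness)]
        have h6 : (8 : ℝ≥0∞) = 2 * 4 := by norm_num
        calc C * (c * (2 * (ε + ε) * m)) = 4 * (C * c) * ε * m := by ring
          _ ≤ 4 * (C * c + 1) * ε * m := by gcongr; exact le_self_add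
          _ = (8 * (C * c + 1 : ℝ≥0∞) * ε) * m / 2 := by
              rw [h6, mul_assoc 2, mul_assoc 2, mul_assoc 2, mul_comm 2, mul_div_assoc,
                ENNReal.div_self (by simp) (by simp), mul_one]
          _ = m / 2 := by rw [h5, one_mul]
      have hm0 : m = 0 := by
        by_contra hne
        exact absurd hm2 (not_le.2 (ENNReal.half_lt_self hne hmt))
      rw [hm0] at hHA
      have h7 := (ae_restrict_iff' hAm).1 (hHA.ae_eq_zero hβ0.le)
      filter_upwards [ih, ae_restrict_of_ae h7, ae_restrict_mem measurableSet_Ioo]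
        with t ht1 ht2 ht3 ht4
      by_cases h8 : t < N * δ
      · exact ht1 h8
      · refine ht2 ⟨⟨not_lt.1 h8, ?_⟩, ht3⟩
        push_cast at ht4
        exact ht4
  obtain ⟨N, hN⟩ := exists_nat_gt (T₀ / δ)
  rw [div_lt_iff₀ hδ0] at hN
  filter_upwards [key N, ae_restrict_mem measurableSet_Ioo] with t ht htm
  exact ht (htm.2.trans hN)

/-! ### The bilinear operator -/

section

variable {n : ℕ}

/-- The Duhamel integral against the absolute value of the kernel. -/
def duhamelAbs (φ : ℝ → Rn n → ℝ≥0∞) (t : ℝ) (x : Rn n) : ℝ≥0∞ :=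
  ∫⁻ s in Ioo 0 t, ∫⁻ y, kernelAbs n (t - s, x - y) * φ s y

/-- The integrand of the `i`-th component of `B[u,v]`. -/
def bilinIntegrand (u v : ℝ → Rn n → Rn n) (t : ℝ) (x : Rn n) (i : Fin n) (z : ℝ × Rn n) : ℝ :=
  ∑ j, ∑ k, gradOseenRep k i j (t - z.1, x - z.2) * (u z.1 z.2 j * v z.1 z.2 k)

/-- Only times s < t enter, and at positive times the kernel gradient agrees with its jointly
measurable representative. -/
theorem opB_eq (u v : ℝ → Rn n → Rn n) (t : ℝ) (x : Rn n) :
    opB u v t x = WithLp.toLp 2 fun i => ∫ s in Ioo 0 t, ∫ y, bilinIntegrand u v t x i (s, y) := by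
  unfold opB opA
  congr 1
  ext i
  refine setIntegral_congr_fun measurableSet_Ioo fun s hs => ?_
  refine integral_congr_ae (Filter.Eventually.of_forall fun y => ?_)
  simp only [bilinIntegrand, Matrix.of_apply]
  refine Finset.sum_congr rfl fun j _ => Finset.sum_congr rfl fun k _ => ?_
  rw [gradOseen_eq k i j (sub_pos.2 hs.2)]
  rfl

/-- The value at every single point depends only on almost-everywhere classes, including points
where the integral takes its default value. This turns almost-everywhere uniqueness into equality of
the bilinear terms everywhere. -/
theorem opB_congr {u v u' v' : ℝ → Rn n → Rn n} {t : ℝ}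
    (hu : ∀ᵐ s ∂(volume.restrict (Ioo 0 t)), ∀ᵐ y, u s y = u' s y)
    (hv : ∀ᵐ s ∂(volume.restrict (Ioo 0 t)), ∀ᵐ y, v s y = v' s y) (x : Rn n) :
    opB u v t x = opB u' v' t x := by
  unfold opB opA
  congr 1
  ext i
  refine integral_congr_ae ?_
  filter_upwards [hu, hv] with s hs hs'
  refine integral_congr_ae ?_
  filter_upwards [hs, hs'] with y hy hy'
  simp only [Matrix.of_apply, hy, hy']

theorem measurable_bilinIntegrand {u v : ℝ → Rn n → Rn n} (hu : Measurable (Function.uncurry u))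
    (hv : Measurable (Function.uncurry v)) (t : ℝ) (x : Rn n) (i : Fin n) :
    Measurable (bilinIntegrand u v t x i) := by
  have hg := fun k i j => measurable_gradOseenRep (n := n) k i j
  have hu' : ∀ j, Measurable fun z : ℝ × Rn n => u z.1 z.2 j := fun j =>
    (EuclideanSpace.proj j : Rn n →L[ℝ] ℝ).measurable.comp hu
  have hv' : ∀ j, Measurable fun z : ℝ × Rn n => v z.1 z.2 j := fun j =>
    (EuclideanSpace.proj j : Rn n →L[ℝ] ℝ).measurable.comp hv
  unfold bilinIntegrand
  fun_prop

theorem enorm_coord_le (x : Rn n) (i : Fin n) : ‖x i‖ₑ ≤ ‖x‖ₑ := by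
  rw [← ofReal_norm, ← ofReal_norm]
  exact ENNReal.ofReal_le_ofReal (PiLp.norm_apply_le x i)

theorem enorm_le_sum_coord (x : Rn n) : ‖x‖ₑ ≤ ∑ i, ‖x i‖ₑ := by
  have h : x = ∑ i, x i • EuclideanSpace.single i (1 : ℝ) := by
    ext j
    simp [Finset.sum_apply, Pi.single_apply]
  calc ‖x‖ₑ = ‖∑ i, x i • EuclideanSpace.single i (1 : ℝ)‖ₑ := by rw [← h]
    _ ≤ ∑ i, ‖x i • EuclideanSpace.single i (1 : ℝ)‖ₑ := enorm_sum_le _ _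
    _ = ∑ i, ‖x i‖ₑ := by
        refine Finset.sum_congr rfl fun i _ => ?_
        rw [enorm_smul, ← ofReal_norm (EuclideanSpace.single i (1 : ℝ))]
        simp

/-- The part of the kernel that enters the `i`-th component. -/
def kernelRowAbs (i : Fin n) (z : ℝ × Rn n) : ℝ≥0∞ := ∑ j, ∑ k, ‖gradOseenRep k i j z‖ₑ

theorem measurable_kernelRowAbs (i : Fin n) : Measurable (kernelRowAbs i) := by
  have := fun k i j => (measurable_gradOseenRep (n := n) k i j).enorm
  unfold kernelRowAbs
  fun_prop

theorem kernelAbs_eq_sum (z : ℝ × Rn n) : kernelAbs n z = ∑ i, kernelRowAbs i z := rfl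

theorem kernelRowAbs_le (i : Fin n) (z : ℝ × Rn n) : kernelRowAbs i z ≤ kernelAbs n z :=
  Finset.single_le_sum (f := fun i => kernelRowAbs i z) (fun _ _ => zero_le) (Finset.mem_univ i)

theorem enorm_sum_kernel_mul_le (i : Fin n) (z : ℝ × Rn n) (w : Fin n → Fin n → ℝ) {A : ℝ≥0∞}
    (hw : ∀ j k, ‖w j k‖ₑ ≤ A) :
    ‖∑ j, ∑ k, gradOseenRep k i j z * w j k‖ₑ ≤ kernelRowAbs i z * A := by
  unfold kernelRowAbs
  rw [Finset.sum_mul]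
  refine (enorm_sum_le _ _).trans (Finset.sum_le_sum fun j _ => ?_)
  rw [Finset.sum_mul]
  refine (enorm_sum_le _ _).trans (Finset.sum_le_sum fun k _ => ?_)
  rw [enorm_mul]
  gcongr
  exact hw j k

theorem integrable_bilinIntegrand {u : ℝ → Rn n → Rn n} (hu : Measurable (Function.uncurry u))
    {t : ℝ} {x : Rn n} (h : duhamelAbs (fun s y => ‖u s y‖ₑ * ‖u s y‖ₑ) t x < ∞) (i : Fin n) :
    Integrable (bilinIntegrand u u t x i)
      ((volume.restrict (Ioo 0 t)).prod (volume : Measure (Rn n))) := by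
  have hm := measurable_bilinIntegrand hu hu t x i
  refine ⟨hm.aestronglyMeasurable, ?_⟩
  rw [HasFiniteIntegral, lintegral_prod _ hm.enorm.aemeasurable]
  refine lt_of_le_of_lt (lintegral_mono fun s => lintegral_mono fun y => ?_) h
  refine (enorm_sum_kernel_mul_le i _ _ fun j k => ?_).trans
    (mul_le_mul' (kernelRowAbs_le i _) le_rfl)
  rw [enorm_mul]
  exact mul_le_mul' (enorm_coord_le _ _) (enorm_coord_le _ _)

theorem enorm_mul_sub_mul_le (x y : Rn n) (j k : Fin n) :
    ‖x j * x k - y j * y k‖ₑ ≤ (‖x‖ₑ + ‖y‖ₑ) * ‖x - y‖ₑ := by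
  have h : x j * x k - y j * y k = x j * (x - y) k + (x - y) j * y k := by
    simp only [PiLp.sub_apply]
    ring
  rw [h]
  refine (enorm_add_le _ _).trans ?_
  rw [enorm_mul, enorm_mul, add_mul, mul_comm ‖(x - y) j‖ₑ]
  exact add_le_add (mul_le_mul' (enorm_coord_le _ _) (enorm_coord_le _ _))
    (mul_le_mul' (enorm_coord_le _ _) (enorm_coord_le _ _))

theorem sum_lintegral_kernelRowAbs {φ : ℝ → Rn n → ℝ≥0∞} (hφ : Measurable (Function.uncurry φ))
    (t : ℝ) (x : Rn n) :
    ∑ i, ∫⁻ s in Ioo 0 t, ∫⁻ y, kernelRowAbs i (t - s, x - y) * φ s y = duhamelAbs φ t x := by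
  have hm : ∀ i, Measurable fun z : ℝ × Rn n =>
      kernelRowAbs i (t - z.1, x - z.2) * φ z.1 z.2 := by
    intro i
    have hsub : Measurable fun z : ℝ × Rn n => (t - z.1, x - z.2) := by fun_prop
    have h₁ : Measurable fun z : ℝ × Rn n => kernelRowAbs i (t - z.1, x - z.2) :=
      (measurable_kernelRowAbs i).comp hsub
    have h₂ : Measurable fun z : ℝ × Rn n => φ z.1 z.2 := hφ
    exact h₁.mul h₂
  have hm₁ : ∀ i, Measurable fun s => ∫⁻ y, kernelRowAbs i (t - s, x - y) * φ s y :=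
    fun i => (hm i).lintegral_prod_right' (ν := volume)
  have hm₂ : ∀ (i : Fin n) (s : ℝ), Measurable fun y : Rn n =>
      kernelRowAbs i (t - s, x - y) * φ s y := by
    intro i s
    have hsub : Measurable fun y : Rn n => (t - s, x - y) := by fun_prop
    have h₁ : Measurable fun y : Rn n => kernelRowAbs i (t - s, x - y) :=
      (measurable_kernelRowAbs i).comp hsub
    have h₂ : Measurable fun y : Rn n => φ s y := hφ.comp measurable_prodMk_left
    exact h₁.mul h₂
  rw [← lintegral_finsetSum _ fun i _ => hm₁ i]
  refine lintegral_congr fun s => ?_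
  rw [← lintegral_finsetSum _ fun i _ => hm₂ i s]
  refine lintegral_congr fun y => ?_
  rw [← Finset.sum_mul, kernelAbs_eq_sum]

theorem opB_sub_opB_apply {u v : ℝ → Rn n → Rn n} (hu : Measurable (Function.uncurry u))
    (hv : Measurable (Function.uncurry v)) {t : ℝ} {x : Rn n}
    (hut : duhamelAbs (fun s y => ‖u s y‖ₑ * ‖u s y‖ₑ) t x < ∞)
    (hvt : duhamelAbs (fun s y => ‖v s y‖ₑ * ‖v s y‖ₑ) t x < ∞) (i : Fin n) :
    (opB u u t x - opB v v t x) i =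
      ∫ z, (bilinIntegrand u u t x i z - bilinIntegrand v v t x i z)
        ∂((volume.restrict (Ioo 0 t)).prod (volume : Measure (Rn n))) := by
  rw [integral_sub (integrable_bilinIntegrand hu hut i) (integrable_bilinIntegrand hv hvt i),
    integral_prod _ (integrable_bilinIntegrand hu hut i),
    integral_prod _ (integrable_bilinIntegrand hv hvt i), opB_eq, opB_eq]
  rfl

theorem enorm_bilinIntegrand_sub_le (u v : ℝ → Rn n → Rn n) (t : ℝ) (x : Rn n) (i : Fin n)
    (s : ℝ) (y : Rn n) :
    ‖bilinIntegrand u u t x i (s, y) - bilinIntegrand v v t x i (s, y)‖ₑ ≤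
      kernelRowAbs i (t - s, x - y) * ((‖u s y‖ₑ + ‖v s y‖ₑ) * ‖u s y - v s y‖ₑ) := by
  have h : bilinIntegrand u u t x i (s, y) - bilinIntegrand v v t x i (s, y) =
      ∑ j, ∑ k, gradOseenRep k i j (t - s, x - y) *
        (u s y j * u s y k - v s y j * v s y k) := by
    simp only [bilinIntegrand, ← Finset.sum_sub_distrib, mul_sub]
  rw [h]
  exact enorm_sum_kernel_mul_le i _ (fun j k => u s y j * u s y k - v s y j * v s y k)
    fun j k => enorm_mul_sub_mul_le _ _ j k

/-- Absolute convergence of both integrals at the point is essential: default values could not be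
subtracted under the integral sign. -/
theorem enorm_opB_sub_opB_le {u v : ℝ → Rn n → Rn n} (hu : Measurable (Function.uncurry u))
    (hv : Measurable (Function.uncurry v)) {t : ℝ} {x : Rn n}
    (hut : duhamelAbs (fun s y => ‖u s y‖ₑ * ‖u s y‖ₑ) t x < ∞)
    (hvt : duhamelAbs (fun s y => ‖v s y‖ₑ * ‖v s y‖ₑ) t x < ∞) :
    ‖opB u u t x - opB v v t x‖ₑ ≤
      duhamelAbs (fun s y => (‖u s y‖ₑ + ‖v s y‖ₑ) * ‖u s y - v s y‖ₑ) t x := by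
  have hA : Measurable (Function.uncurry fun s y =>
      (‖u s y‖ₑ + ‖v s y‖ₑ) * ‖u s y - v s y‖ₑ) :=
    (hu.enorm.add hv.enorm).mul (hu.sub hv).enorm
  rw [← sum_lintegral_kernelRowAbs hA]
  refine (enorm_le_sum_coord _).trans (Finset.sum_le_sum fun i _ => ?_)
  rw [opB_sub_opB_apply hu hv hut hvt i]
  refine (enorm_integral_le_lintegral_enorm _).trans ?_
  have hd : Measurable fun z => ‖bilinIntegrand u u t x i z - bilinIntegrand v v t x i z‖ₑ :=
    ((measurable_bilinIntegrand hu hu t x i).sub (measurable_bilinIntegrand hv hv t x i)).enorm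
  rw [lintegral_prod _ hd.aemeasurable]
  exact lintegral_mono fun s => lintegral_mono fun y => enorm_bilinIntegrand_sub_le u v t x i s y

theorem measurable_duhamelAbs {φ : ℝ → Rn n → ℝ≥0∞} (hφ : Measurable (Function.uncurry φ))
    (t : ℝ) : Measurable (duhamelAbs φ t) := by
  have hk := measurable_kernelAbs n
  have h1 : Measurable fun z : (Rn n × ℝ) × Rn n =>
      kernelAbs n (t - z.1.2, z.1.1 - z.2) * φ z.1.2 z.2 :=
    (hk.comp (by fun_prop)).mul (hφ.comp (by fun_prop : Measurable fun z : (Rn n × ℝ) × Rn n =>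
      (z.1.2, z.2)))
  exact (h1.lintegral_prod_right' (ν := volume)).lintegral_prod_right'
    (ν := volume.restrict (Ioo 0 t))

/-- The spatial bilinear estimate for the Duhamel integral. -/
theorem exists_weakBound_duhamelAbs (n : ℕ) (θ : ℝ) (hθ0 : 0 ≤ θ) (hθ : θ < 1 / 2) :
    ∃ C : ℝ≥0, ∀ (g h : ℝ → Rn n → ℝ≥0∞) (t : ℝ), Measurable (Function.uncurry g) →
      Measurable (Function.uncurry h) →
      WeakBound volume θ (duhamelAbs (fun s y => g s y * h s y) t)
        (C * ∫⁻ s in Ioo 0 t, ENNReal.ofReal (t - s) ^ (-(1 / 2 + n * θ / 2)) *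
          (weakNorm volume θ (g s) * weakNorm volume θ (h s))) := by
  obtain ⟨C, hC⟩ := exists_setLIntegral_kernelAbs_le n θ hθ0 hθ
  refine ⟨C, fun g h t hg hh => ?_⟩
  have hgs : ∀ s, Measurable (g s) := fun s => hg.comp measurable_prodMk_left
  have hhs : ∀ s, Measurable (h s) := fun s => hh.comp measurable_prodMk_left
  have hgh : Measurable (Function.uncurry fun s y => g s y * h s y) := hg.mul hh
  have hWg : Measurable fun s => weakNorm volume θ (g s) := measurable_weakNorm hθ0 hg
  have hWh : Measurable fun s => weakNorm volume θ (h s) := measurable_weakNorm hθ0 hh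
  refine weakBound_of_setLIntegral_le hθ0 (measurable_duhamelAbs hgh t) fun E hE hEt => ?_
  have hk := measurable_kernelAbs n
  have h1 : Measurable fun z : (Rn n × ℝ) × Rn n =>
      kernelAbs n (t - z.1.2, z.1.1 - z.2) * (g z.1.2 z.2 * h z.1.2 z.2) :=
    (hk.comp (by fun_prop)).mul (hgh.comp (by fun_prop : Measurable fun z : (Rn n × ℝ) × Rn n =>
      (z.1.2, z.2)))
  unfold duhamelAbs
  rw [lintegral_lintegral_swap (h1.lintegral_prod_right' (ν := volume)).aemeasurable,
    ← lintegral_const_mul _ (by fun_prop), ← lintegral_mul_const _ (by fun_prop)]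
  refine setLIntegral_mono' measurableSet_Ioo fun s hs => ?_
  refine (hC (t - s) (g s) (h s) (sub_pos.2 hs.2) (hgs s) (hhs s) E hE hEt).trans_eq ?_
  ring

/-- Uniqueness for measurable solutions whose weak norms vanish in time. -/
theorem ae_eq_of_add_opB_eq {θ β T₀ : ℝ} (hθ0 : 0 ≤ θ) (hθ : θ < 1 / 2) (hβ0 : 0 < β)
    (hβ : β < 1 / 2) (hθβ : 1 / 2 + n * θ / 2 ≤ 1 - β) {u v : ℝ → Rn n → Rn n}
    (hu : Measurable (Function.uncurry u)) (hv : Measurable (Function.uncurry v))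
    (hGu : WeakVanishing (volume.restrict (Ioo 0 T₀)) β
      fun t => weakNorm volume θ fun x => ‖u t x‖ₑ)
    (hGv : WeakVanishing (volume.restrict (Ioo 0 T₀)) β
      fun t => weakNorm volume θ fun x => ‖v t x‖ₑ)
    (heq : ∀ᵐ t ∂(volume.restrict (Ioo 0 T₀)), ∀ᵐ x,
      u t x + opB u u t x = v t x + opB v v t x) :
    ∀ᵐ t ∂(volume.restrict (Ioo 0 T₀)), ∀ᵐ x, u t x = v t x := by
  set Gu := fun t => weakNorm volume θ fun x => ‖u t x‖ₑ with hGudef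
  set Gv := fun t => weakNorm volume θ fun x => ‖v t x‖ₑ with hGvdef
  set H := fun t => weakNorm volume θ fun x => ‖u t x - v t x‖ₑ with hHdef
  have hGum : Measurable Gu := measurable_weakNorm hθ0 hu.enorm
  have hGvm : Measurable Gv := measurable_weakNorm hθ0 hv.enorm
  have hHm : Measurable H := measurable_weakNorm hθ0 (hu.sub hv).enorm
  have hsumW : ∀ t, weakNorm volume θ (fun x => ‖u t x‖ₑ + ‖v t x‖ₑ) ≤ 2 * (Gu t + Gv t) :=
    fun t => weakNorm_le ((weakBound_weakNorm hθ0).add hθ0 (by linarith) (weakBound_weakNorm hθ0))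
  have hHle : ∀ t, H t ≤ 2 * (Gu t + Gv t) := fun t =>
    weakNorm_le (((weakBound_weakNorm hθ0).mono hθ0 (Filter.Eventually.of_forall fun x =>
      enorm_sub_le)).mono_bound (hsumW t))
  obtain ⟨Mu, hMu, hMu'⟩ := hGu.exists_weakBound hβ0.le
  obtain ⟨Mv, hMv, hMv'⟩ := hGv.exists_weakBound hβ0.le
  have hMH : WeakBound (volume.restrict (Ioo 0 T₀)) β H
      (2 * (2 * (Mu + Mv) + 2 * (Mu + Mv))) := by
    have h1 := hMu'.add hβ0.le (by linarith) hMv'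
    refine (h1.add hβ0.le (by linarith) h1).mono hβ0.le (Filter.Eventually.of_forall fun t => ?_)
    exact (hHle t).trans_eq (two_mul _)
  obtain ⟨C, hC⟩ := exists_weakBound_duhamelAbs n θ hθ0 hθ
  obtain ⟨c, hc⟩ := exists_volterra_setLIntegral_le (T₀ := T₀) hβ0 hβ hθβ
  -- Absolute convergence at almost every (t,x): the Volterra bound makes the time integral finite
  -- for almost every t, and the spatial weak bound then makes the Duhamel integral finite for
  -- almost every x.
  have hfin : ∀ (w : ℝ → Rn n → Rn n), Measurable (Function.uncurry w) → ∀ M : ℝ≥0∞, M ≠ ∞ →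
      WeakBound (volume.restrict (Ioo 0 T₀)) β (fun t => weakNorm volume θ fun x => ‖w t x‖ₑ) M →
      ∀ᵐ t ∂(volume.restrict (Ioo 0 T₀)), ∀ᵐ x,
        duhamelAbs (fun s y => ‖w s y‖ₑ * ‖w s y‖ₑ) t x < ∞ := by
    intro w hw M hM hwM
    have hWm : Measurable fun t => weakNorm volume θ fun x => ‖w t x‖ₑ :=
      measurable_weakNorm hθ0 hw.enorm
    have h1 := weakBound_of_setLIntegral_le hβ0.le
      ((measurable_volterra hWm hWm measurableSet_Ioo).indicator measurableSet_Ioo)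
      (hc _ _ (Ioo 0 T₀) M M hWm hWm measurableSet_Ioo Subset.rfl hwM hwM)
    have h2 := h1.ae_lt_top hβ0.le (ENNReal.mul_ne_top ENNReal.coe_ne_top
      (ENNReal.mul_ne_top hM hM))
    rw [ae_restrict_iff' measurableSet_Ioo]
    filter_upwards [h2] with t ht htT
    rw [indicator_of_mem htT, inter_eq_left.2 (Ioo_subset_Ioo_right htT.2.le)] at ht
    exact (hC (fun s y => ‖w s y‖ₑ) (fun s y => ‖w s y‖ₑ) t hw.enorm hw.enorm).ae_lt_top hθ0
      (ENNReal.mul_lt_top ENNReal.coe_lt_top ht).ne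
  have hineq : ∀ᵐ t ∂(volume.restrict (Ioo 0 T₀)), H t ≤ ((2 * C : ℝ≥0) : ℝ≥0∞) *
      ∫⁻ s in Ioo 0 t, ENNReal.ofReal (t - s) ^ (-(1 / 2 + n * θ / 2)) *
        ((Gu s + Gv s) * H s) := by
    filter_upwards [hfin u hu Mu hMu hMu', hfin v hv Mv hMv hMv', heq] with t htu htv hteq
    have h1 := hC (fun s y => ‖u s y‖ₑ + ‖v s y‖ₑ) (fun s y => ‖u s y - v s y‖ₑ) t
      (hu.enorm.add hv.enorm) (hu.sub hv).enorm
    have h2 : ∀ᵐ x, ‖u t x - v t x‖ₑ ≤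
        duhamelAbs (fun s y => (‖u s y‖ₑ + ‖v s y‖ₑ) * ‖u s y - v s y‖ₑ) t x := by
      filter_upwards [htu, htv, hteq] with x hxu hxv hx
      refine le_trans (le_of_eq ?_) (enorm_opB_sub_opB_le hu hv hxu hxv)
      have : u t x - v t x = -(opB u u t x - opB v v t x) := by
        rw [neg_sub, sub_eq_sub_iff_add_eq_add, hx, add_comm]
      rw [this, enorm_neg]
    refine (weakNorm_le (h1.mono hθ0 h2)).trans ?_
    rw [ENNReal.coe_mul, ENNReal.coe_ofNat, mul_comm (2 : ℝ≥0∞), mul_assoc]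
    refine mul_le_mul' le_rfl ?_
    rw [← lintegral_const_mul' _ _ ENNReal.ofNat_ne_top]
    refine lintegral_mono fun s => ?_
    calc _ ≤ ENNReal.ofReal (t - s) ^ (-(1 / 2 + n * θ / 2)) *
          (2 * (Gu s + Gv s) * H s) := by
          gcongr
          exact hsumW s
      _ = _ := by ring
  have hfinM : (2 * (2 * (Mu + Mv) + 2 * (Mu + Mv)) : ℝ≥0∞) ≠ ∞ := by finiteness
  have h0 := ae_eq_zero_of_le_volterra hβ0 hβ hθβ hGum hGvm hHm hGu hGv hfinM hMH hineq
  filter_upwards [h0] with t ht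
  have h3 : WeakBound volume θ (fun x => ‖u t x - v t x‖ₑ) 0 := by
    have := weakBound_weakNorm (μ := volume) (g := fun x => ‖u t x - v t x‖ₑ) hθ0
    rwa [show weakNorm volume θ (fun x => ‖u t x - v t x‖ₑ) = 0 from ht] at this
  filter_upwards [h3.ae_eq_zero hθ0] with x hx
  exact sub_eq_zero.1 (enorm_eq_zero.1 hx)

end

/-! ### Weak norms of the path spaces -/

theorem weakBound_lorentz {X : Type*} [MeasurableSpace X] (μ : Measure X) (p : ℝ≥0∞)
    (g : X → ℝ≥0∞) : WeakBound μ (p⁻¹).toReal g (lorentz μ p ∞ g) := by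
  set θ := (p⁻¹).toReal with hθ
  have hθ0 : 0 ≤ θ := ENNReal.toReal_nonneg
  set L := lorentz μ p ∞ g with hL
  have hLle : ∀ y : ℝ≥0∞, 0 < y → y < ∞ → ∀ t : ℝ, 0 < t →
      ENNReal.ofReal t < μ {x | y < g x} → ENNReal.ofReal t ^ θ * y ≤ L := by
    intro y hy0 hy t ht htl
    rw [hL, lorentz, if_pos rfl]
    refine le_trans ?_ (le_iSup₂ (f := fun (t : ℝ) (_ : t ∈ Ioi (0 : ℝ)) =>
      ENNReal.ofReal t ^ (p⁻¹).toReal * rearrangement μ g (ENNReal.ofReal t)) t ht)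
    gcongr
    exact le_sSup ⟨hy0, hy, htl⟩
  intro y
  by_cases hl : μ {x | y < g x} = 0
  · simp [posRpow, hl]
  rcases eq_or_ne y 0 with rfl | hy0
  · simp
  have hyt : y ≠ ∞ := by
    rintro rfl
    simp at hl
  rw [posRpow, if_neg hl]
  set l := μ {x | y < g x} with hldef
  by_contra! hc
  have h1 : L / y < l ^ θ := by
    refine (ENNReal.div_lt_iff (Or.inl hy0) (Or.inl hyt)).2 ?_
    rwa [mul_comm]
  -- The rearrangement reaches level y only for t strictly below λ(y), so λ(y) itself is approached
  -- from the left by continuity of z^θ. This also covers λ(y) = ∞.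
  have h2 : ∀ᶠ z in nhds l, L / y < z ^ θ :=
    (ENNReal.continuous_rpow_const.tendsto l).eventually (lt_mem_nhds h1)
  have hne : (nhdsWithin l (Iio l)).NeBot :=
    nhdsLT_neBot_of_exists_lt ⟨0, pos_iff_ne_zero.2 hl⟩
  have h4 : ∀ᶠ z in nhdsWithin l (Iio l), L / y < z ^ θ ∧ z < l ∧ 0 < z := by
    filter_upwards [h2.filter_mono nhdsWithin_le_nhds, self_mem_nhdsWithin,
      mem_nhdsWithin_of_mem_nhds (lt_mem_nhds (pos_iff_ne_zero.2 hl))] with z h1 h2 h3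
    exact ⟨h1, h2, h3⟩
  obtain ⟨z, hz1, hz2, hz3⟩ := h4.exists
  have hzt : z ≠ ∞ := ne_top_of_lt hz2
  have h3 := hLle y (pos_iff_ne_zero.2 hy0) hyt.lt_top z.toReal
    (ENNReal.toReal_pos hz3.ne' hzt) (by rw [ENNReal.ofReal_toReal hzt]; exact hz2)
  rw [ENNReal.ofReal_toReal hzt] at h3
  exact absurd h3 (not_le.2 ((ENNReal.div_lt_iff (Or.inl hy0) (Or.inl hyt)).1 hz1))

/-- For ∞bar the exponent θ is 0, and a superlevel set of positive measure contains a point, so the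
pointwise supremum dominates. -/
theorem weakNorm_le_lorentzNorm {n : ℕ} (r : Exponent) (g : Rn n → Rn n) :
    weakNorm volume r.recip (fun x => ‖g x‖ₑ) ≤ lorentzNorm r ∞ g := by
  cases r with
  | std p => exact weakNorm_le (weakBound_lorentz _ _ _)
  | bar =>
    refine weakNorm_le fun y => ?_
    simp only [lorentzNorm, Exponent.recip, Exponent.toENNReal, ENNReal.inv_top,
      ENNReal.toReal_zero]
    by_cases hl : volume {x | y < ‖g x‖ₑ} = 0
    · simp [posRpow, hl]
    · rw [posRpow, if_neg hl, ENNReal.rpow_zero, mul_one]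
      obtain ⟨x, hx⟩ := nonempty_of_measure_ne_zero hl
      exact (le_of_lt hx).trans (le_iSup (fun x => ‖g x‖ₑ) x)

theorem timeInterval_coe (T : ℝ) : timeInterval (T : EReal) = Ioo 0 T := by
  ext t
  change (0 < t ∧ (t : EReal) < (T : EReal)) ↔ _
  rw [EReal.coe_lt_coe_iff]
  rfl

theorem measurableSet_timeInterval (T : EReal) : MeasurableSet (timeInterval T) :=
  (measurableSet_lt measurable_const measurable_id).inter
    (measurableSet_lt measurable_coe_real_ereal measurable_const)

/-- Power weights that are subcritical at the origin vanish in the weak norm. -/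
theorem weakVanishing_rpow {β b T₀ : ℝ} (hb0 : 0 < b) (hb : b < β) {c : ℝ≥0∞} (hc : c ≠ ∞) :
    WeakVanishing (volume.restrict (Ioo 0 T₀)) β fun t => c * ENNReal.ofReal t ^ (-b) := by
  intro ε hε
  have he : 0 < β / b - 1 := by
    rw [sub_pos, lt_div_iff₀ hb0]
    linarith
  -- The superlevel set at y has length at most (c/y)^{1/b}, so the weak quantity is at most c^{β/b}
  -- y^{1-β/b}; D is where this drops to ε.
  set D := (c ^ (β / b) / ε) ^ (β / b - 1)⁻¹ with hD
  have hβb : 0 ≤ β / b := by linarith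
  refine ⟨max 1 D, ?_, fun y hy => ?_⟩
  · refine ne_of_lt (max_lt ENNReal.one_lt_top ?_)
    refine ENNReal.rpow_lt_top_of_nonneg (inv_nonneg.2 he.le) ?_
    exact (ENNReal.div_lt_top (ENNReal.rpow_ne_top_of_nonneg hβb hc) hε).ne
  have hy0 : y ≠ 0 := (lt_of_lt_of_le one_pos ((le_max_left _ _).trans hy)).ne'
  rcases eq_or_ne y ∞ with rfl | hyt
  · simp [posRpow]
  have hset : (volume.restrict (Ioo 0 T₀)) {t : ℝ | y < c * ENNReal.ofReal t ^ (-b)} ≤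
      (c / y) ^ b⁻¹ := by
    have hB : (c / y) ^ b⁻¹ ≠ ∞ := ENNReal.rpow_ne_top_of_nonneg (inv_nonneg.2 hb0.le)
      (ENNReal.div_lt_top hc hy0).ne
    rw [Measure.restrict_apply' measurableSet_Ioo]
    calc volume ({t : ℝ | y < c * ENNReal.ofReal t ^ (-b)} ∩ Ioo 0 T₀)
        ≤ volume (Icc (0 : ℝ) ((c / y) ^ b⁻¹).toReal) := by
          refine measure_mono ?_
          rintro t ⟨ht1, ht2⟩
          have ht1 : y < c * ENNReal.ofReal t ^ (-b) := ht1
          have ht0 : ENNReal.ofReal t ≠ 0 := by simpa using ht2.1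
          refine ⟨ht2.1.le, ?_⟩
          rw [← ENNReal.ofReal_le_iff_le_toReal hB, ENNReal.le_rpow_inv_iff hb0]
          rw [ENNReal.le_div_iff_mul_le (Or.inl hy0) (Or.inl hyt)]
          rw [ENNReal.rpow_neg, ← div_eq_mul_inv, ENNReal.lt_div_iff_mul_lt
            (Or.inl (by simp [ENNReal.rpow_eq_zero_iff, ht0]))
            (Or.inl (by simp [ENNReal.rpow_eq_top_iff, ht0]))] at ht1
          rw [mul_comm]
          exact ht1.le
      _ = (c / y) ^ b⁻¹ := by rw [Real.volume_Icc, sub_zero, ENNReal.ofReal_toReal hB]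
  have h1 : c ^ (β / b) / ε ≤ y ^ (β / b - 1) := by
    have := (le_max_right 1 D).trans hy
    rwa [hD, ENNReal.rpow_inv_le_iff he] at this
  calc y * posRpow β ((volume.restrict (Ioo 0 T₀)) {t : ℝ | y < c * ENNReal.ofReal t ^ (-b)})
      ≤ y * ((c / y) ^ b⁻¹) ^ β := by
        gcongr
        exact (posRpow_le_rpow _).trans (ENNReal.rpow_le_rpow hset (by linarith))
    _ = y * (c ^ (β / b) / y ^ (β / b)) := by
        rw [← ENNReal.rpow_mul, ← ENNReal.div_rpow_of_nonneg _ _ hβb, div_eq_inv_mul]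
    _ = c ^ (β / b) / y ^ (β / b - 1) := by
        rw [ENNReal.rpow_sub _ _ hy0 hyt, ENNReal.rpow_one]
        generalize c ^ (β / b) = A
        generalize y ^ (β / b) = Y
        rw [div_eq_mul_inv A (Y / y), ENNReal.inv_div (Or.inl hyt) (Or.inl hy0), div_eq_mul_inv,
          div_eq_mul_inv]
        ring
    _ ≤ ε := by
        refine ENNReal.div_le_of_le_mul ?_
        rw [mul_comm]
        refine (ENNReal.div_le_iff_le_mul (Or.inl hε) (Or.inr ?_)).1 h1
        simp [ENNReal.rpow_eq_zero_iff, hy0, hyt]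

theorem MemK.weakVanishing {n : ℕ} {r : Exponent} {σ T₀ β : ℝ} (hβ0 : 0 < β) (hσ : -σ / 2 < β)
    {u : ℝ → Rn n → Rn n} (hu : MemK r ∞ σ (T₀ : EReal) u) :
    WeakVanishing (volume.restrict (Ioo 0 T₀)) β
      fun t => weakNorm volume r.recip fun x => ‖u t x‖ₑ := by
  obtain ⟨-, h⟩ := hu
  rw [timeInterval_coe] at h
  set c := essSup (fun t => ENNReal.ofReal t ^ (-σ / 2) * lorentzNorm r ∞ (u t))
    (volume.restrict (Ioo 0 T₀)) with hc
  -- The midpoint between max(-σ/2, 0) and β. Then t^{σ/2} ≤ T₀^{σ/2+b} t^{-b} on the interval, and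
  -- b > 0 even when σ ≥ 0.
  set b := (max (-σ / 2) 0 + β) / 2 with hb
  have hmax : max (-σ / 2) 0 < β := max_lt hσ hβ0
  have hb0 : 0 < b := by linarith [le_max_right (-σ / 2) 0]
  have hbβ : b < β := by linarith
  have hσb : 0 ≤ σ / 2 + b := by linarith [le_max_left (-σ / 2) 0]
  have hC : c * ENNReal.ofReal (T₀ ^ (σ / 2 + b)) ≠ ∞ :=
    ENNReal.mul_ne_top h.ne ENNReal.ofReal_ne_top
  refine (weakVanishing_rpow hb0 hbβ hC).mono hβ0.le ?_
  filter_upwards [ENNReal.ae_le_essSup (μ := volume.restrict (Ioo 0 T₀))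
    fun t => ENNReal.ofReal t ^ (-σ / 2) * lorentzNorm r ∞ (u t),
    ae_restrict_mem measurableSet_Ioo] with t ht htT
  refine (weakNorm_le_lorentzNorm r (u t)).trans ?_
  have ht0 : ENNReal.ofReal t ≠ 0 := by simpa using htT.1
  have hcancel : ENNReal.ofReal t ^ (σ / 2) * ENNReal.ofReal t ^ (-σ / 2) = 1 := by
    rw [← ENNReal.rpow_add _ _ ht0 ENNReal.ofReal_ne_top]
    ring_nf
    simp
  calc lorentzNorm r ∞ (u t)
      = ENNReal.ofReal t ^ (σ / 2) * (ENNReal.ofReal t ^ (-σ / 2) * lorentzNorm r ∞ (u t)) := by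
        rw [← mul_assoc, hcancel, one_mul]
    _ ≤ ENNReal.ofReal t ^ (σ / 2) * c := by gcongr
    _ = c * ENNReal.ofReal t ^ (σ / 2 + b) * ENNReal.ofReal t ^ (-b) := by
        rw [mul_assoc, ← ENNReal.rpow_add _ _ ht0 ENNReal.ofReal_ne_top, mul_comm]
        congr 2
        ring
    _ ≤ c * ENNReal.ofReal (T₀ ^ (σ / 2 + b)) * ENNReal.ofReal t ^ (-b) := by
        rw [ENNReal.ofReal_rpow_of_pos htT.1]
        gcongr
        · exact htT.1.le
        · exact htT.2.le

/-- Functions in `L^{α,q}` with `q < ∞`, on a bounded interval, vanish in the weak norm. -/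
theorem weakVanishing_of_lorentz_lt_top {α q T₀ : ℝ} (hα : 0 < α) (hq : 0 < q) {g : ℝ → ℝ≥0∞}
    (h : lorentz volume (ENNReal.ofReal α) (ENNReal.ofReal q) ((Ioo 0 T₀).indicator g) < ∞) :
    WeakVanishing (volume.restrict (Ioo 0 T₀)) α⁻¹ g := by
  set G := (Ioo 0 T₀).indicator g with hG
  have hinv : ((ENNReal.ofReal α)⁻¹).toReal = α⁻¹ := by
    rw [ENNReal.toReal_inv, ENNReal.toReal_ofReal hα.le]
  set F : ℝ → ℝ≥0∞ := fun t => (ENNReal.ofReal t ^ α⁻¹ *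
    rearrangement volume G (ENNReal.ofReal t)) ^ q / ENNReal.ofReal t with hF
  have hJ : ∫⁻ t in Ioi (0 : ℝ), F t ≠ ∞ := by
    rw [lorentz, if_neg ENNReal.ofReal_ne_top, hinv, ENNReal.toReal_ofReal hq.le] at h
    intro htop
    change (_ * ∫⁻ t in Ioi (0 : ℝ), F t) ^ _ < ∞ at h
    rw [htop, ENNReal.mul_top (ENNReal.div_pos (by simpa using hq) ENNReal.ofReal_ne_top).ne',
      ENNReal.top_rpow_of_pos (inv_pos.2 hq)] at h
    exact lt_irrefl _ h
  have hl : ∀ y, (volume.restrict (Ioo 0 T₀)) {t | y < g t} = volume {t | y < G t} := by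
    intro y
    rw [Measure.restrict_apply' measurableSet_Ioo]
    congr 1
    ext t
    by_cases ht : t ∈ Ioo 0 T₀
    · simp [hG, ht]
    · simp [hG, ht]
  have hlfin : ∀ y, volume {t | y < G t} ≠ ∞ := by
    intro y
    rw [← hl]
    exact measure_ne_top _ _
  set κ := 1 - q / α with hκ
  have hqα : 0 < q / α := by positivity
  -- On (0, λ(y)) the rearrangement is at least y; integrating t^{q/α-1} there bounds the weak
  -- quantity by a piece of the Lorentz integral near 0.
  have key : ∀ y : ℝ≥0∞, y ≠ 0 → y ≠ ∞ →
      y ^ q * volume {t | y < G t} ^ (q / α) ≤ ENNReal.ofReal (q / α) *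
        ∫⁻ t in Ioo 0 (volume {t | y < G t}).toReal, F t := by
    intro y hy0 hyt
    set l := volume {t | y < G t} with hldef
    have h1 : ∫⁻ t in Ioo 0 l.toReal, y ^ q * ENNReal.ofReal t ^ (-κ) ≤
        ∫⁻ t in Ioo 0 l.toReal, F t := by
      refine setLIntegral_mono' measurableSet_Ioo fun t ht => ?_
      have ht0 : ENNReal.ofReal t ≠ 0 := by simpa using ht.1
      have hy : y ≤ rearrangement volume G (ENNReal.ofReal t) := by
        refine le_sSup ⟨pos_iff_ne_zero.2 hy0, hyt.lt_top, ?_⟩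
        exact (ENNReal.ofReal_lt_iff_lt_toReal ht.1.le (hlfin y)).2 ht.2
      have h2 : y ^ q * ENNReal.ofReal t ^ (-κ) =
          (ENNReal.ofReal t ^ α⁻¹ * y) ^ q / ENNReal.ofReal t := by
        rw [ENNReal.mul_rpow_of_nonneg _ _ hq.le, ← ENNReal.rpow_mul, div_eq_mul_inv,
          ← ENNReal.rpow_neg_one, mul_right_comm, ← ENNReal.rpow_add _ _ ht0 ENNReal.ofReal_ne_top,
          mul_comm]
        congr 2
        rw [hκ]
        field_simp
        ring
      rw [h2]
      simp only [hF]
      gcongr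
    rw [lintegral_const_mul _ (by fun_prop), lintegral_rpow_neg (by linarith)
      ENNReal.toReal_nonneg, show 1 - κ = q / α by rw [hκ]; ring] at h1
    have h3 : ENNReal.ofReal (q / α) * ENNReal.ofReal (l.toReal ^ (q / α) / (q / α)) =
        l ^ (q / α) := by
      rw [← ENNReal.ofReal_mul hqα.le, mul_div_cancel₀ _ hqα.ne',
        ← ENNReal.ofReal_rpow_of_nonneg ENNReal.toReal_nonneg hqα.le,
        ENNReal.ofReal_toReal (hlfin y)]
    calc y ^ q * l ^ (q / α)
        = ENNReal.ofReal (q / α) * (y ^ q * ENNReal.ofReal (l.toReal ^ (q / α) / (q / α))) := by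
          rw [← h3]; ring
      _ ≤ _ := by gcongr
  intro ε hε
  have hqα' : ENNReal.ofReal (q / α) ≠ 0 := by simpa using hqα
  set ε₁ := ε ^ q / ENNReal.ofReal (q / α) with hε₁
  have hε₁0 : ε₁ ≠ 0 := by
    rw [hε₁]
    refine (ENNReal.div_pos ?_ ENNReal.ofReal_ne_top).ne'
    simp [ENNReal.rpow_eq_zero_iff, hε, not_lt.2 hq.le]
  -- Absolute continuity of the integral. Here q < ∞ enters: the piece over (0, λ(y)) is small once
  -- λ(y) < δ, and the threshold D below makes λ(y) that small.
  obtain ⟨δ', hδ'0, hδ'⟩ := exists_pos_setLIntegral_lt_of_measure_lt hJ hε₁0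
  set δ := min δ' 1 with hδ
  have hδ0 : δ ≠ 0 := (lt_min hδ'0 one_pos).ne'
  have hδt : δ ≠ ∞ := ne_top_of_le_ne_top ENNReal.one_ne_top (min_le_right _ _)
  set K := ENNReal.ofReal (q / α) * ∫⁻ t in Ioi (0 : ℝ), F t with hK
  have hKt : K ≠ ∞ := ENNReal.mul_ne_top ENNReal.ofReal_ne_top hJ
  have hδp0 : δ ^ (q / α) ≠ 0 := by simp [ENNReal.rpow_eq_zero_iff, hδ0, hδt]
  have hδpt : δ ^ (q / α) ≠ ∞ := ENNReal.rpow_ne_top_of_nonneg hqα.le hδt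
  set D := ((K + 1) / δ ^ (q / α)) ^ q⁻¹ with hD
  refine ⟨max 1 D, ?_, fun y hy => ?_⟩
  · refine ne_of_lt (max_lt ENNReal.one_lt_top ?_)
    refine ENNReal.rpow_lt_top_of_nonneg (inv_nonneg.2 hq.le) ?_
    exact (ENNReal.div_lt_top (by finiteness) hδp0).ne
  have hy0 : y ≠ 0 := (lt_of_lt_of_le one_pos ((le_max_left _ _).trans hy)).ne'
  rcases eq_or_ne y ∞ with rfl | hyt
  · simp [posRpow]
  rw [hl]
  set l := volume {t | y < G t} with hldef
  have hlδ : l < δ := by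
    by_contra! hcon
    have h1 : (K + 1) / δ ^ (q / α) ≤ y ^ q := by
      have := (le_max_right 1 D).trans hy
      rwa [hD, ENNReal.rpow_inv_le_iff hq] at this
    have h2 : K + 1 ≤ y ^ q * δ ^ (q / α) :=
      (ENNReal.div_le_iff_le_mul (Or.inl hδp0) (Or.inl hδpt)).1 h1
    have h3 : y ^ q * δ ^ (q / α) ≤ K := by
      calc y ^ q * δ ^ (q / α) ≤ y ^ q * l ^ (q / α) := by gcongr
        _ ≤ _ := key y hy0 hyt
        _ ≤ K := by
            rw [hK]
            gcongr
            exact Ioo_subset_Ioi_self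
    exact absurd (h2.trans h3) (not_le.2 (ENNReal.lt_add_right hKt one_ne_zero))
  have h4 : ∫⁻ t in Ioo 0 l.toReal, F t ≤ ε₁ := by
    have h5 := hδ' (Ioo 0 l.toReal) (by
      rw [Measure.restrict_apply measurableSet_Ioo, inter_eq_left.2 Ioo_subset_Ioi_self,
        Real.volume_Ioo, sub_zero, ENNReal.ofReal_toReal (hlfin y)]
      exact hlδ.trans_le (min_le_left _ _))
    rw [Measure.restrict_restrict measurableSet_Ioo, inter_eq_left.2 Ioo_subset_Ioi_self] at h5
    exact h5.le
  have h6 : (y * l ^ α⁻¹) ^ q ≤ ε ^ q := by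
    calc (y * l ^ α⁻¹) ^ q = y ^ q * l ^ (q / α) := by
          rw [ENNReal.mul_rpow_of_nonneg _ _ hq.le, ← ENNReal.rpow_mul]
          congr 2
          field_simp
      _ ≤ ENNReal.ofReal (q / α) * ε₁ := (key y hy0 hyt).trans (by gcongr)
      _ = ε ^ q := by rw [hε₁, ENNReal.mul_div_cancel hqα' ENNReal.ofReal_ne_top]
  refine le_trans ?_ ((ENNReal.rpow_le_rpow_iff hq).1 h6)
  gcongr
  exact posRpow_le_rpow _

theorem MemL.weakVanishing {n : ℕ} {r : Exponent} {α q T₀ : ℝ} (hα : 0 < α) (hq : 0 < q)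
    {u : ℝ → Rn n → Rn n}
    (hu : MemL r ∞ (ENNReal.ofReal α) (ENNReal.ofReal q) (T₀ : EReal) u) :
    WeakVanishing (volume.restrict (Ioo 0 T₀)) α⁻¹
      fun t => weakNorm volume r.recip fun x => ‖u t x‖ₑ := by
  obtain ⟨-, h⟩ := hu
  rw [timeInterval_coe] at h
  exact (weakVanishing_of_lorentz_lt_top hα hq h).mono (inv_nonneg.2 hα.le)
    (Filter.Eventually.of_forall fun t => weakNorm_le_lorentzNorm r (u t))

theorem MemJ.memK {n : ℕ} {r : Exponent} {q : ℝ≥0∞} {σ : ℝ} {T : EReal} {u : ℝ → Rn n → Rn n}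
    (hu : MemJ r q σ T u) : MemK r q σ T u := by
  refine ⟨hu.1, lt_of_le_of_lt (essSup_le_of_ae_le _ ?_) hu.2⟩
  filter_upwards [ae_restrict_mem (measurableSet_timeInterval T)] with t ht
  exact le_iSup₂ (f := fun (t : ℝ) (_ : t ∈ timeInterval T) =>
    ENNReal.ofReal t ^ (-σ / 2) * lorentzNorm r q (u t)) t ht

/-! ### Uniqueness -/

theorem MeasurablePath.exists_measurable {n : ℕ} {T₀ : ℝ} {u : ℝ → Rn n → Rn n}
    (hu : MeasurablePath (T₀ : EReal) u) :
    ∃ u' : ℝ → Rn n → Rn n, Measurable (Function.uncurry u') ∧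
      ∀ᵐ t ∂(volume.restrict (Ioo 0 T₀)), ∀ᵐ x, u t x = u' t x := by
  unfold MeasurablePath at hu
  rw [timeInterval_coe] at hu
  obtain ⟨g, hg, h⟩ := hu
  rw [Measure.volume_eq_prod, ← Measure.prod_restrict, Measure.restrict_univ] at h
  exact ⟨fun t x => g (t, x), hg, Measure.ae_ae_of_ae_prod h⟩

theorem ae_restrict_Ioo_of_lt {P : ℝ → Prop} {t T₀ : ℝ}
    (h : ∀ᵐ s ∂(volume.restrict (Ioo 0 T₀)), P s) (ht : t ≤ T₀) :
    ∀ᵐ s ∂(volume.restrict (Ioo 0 t)), P s :=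
  ae_restrict_of_ae_restrict_of_subset (Ioo_subset_Ioo_right ht) h

/-- Uniqueness for solutions on a bounded interval whose weak norms vanish in time. -/
theorem ae_eq_of_weakVanishing {n : ℕ} {θ β T₀ : ℝ} (hθ0 : 0 ≤ θ) (hθ : θ < 1 / 2) (hβ0 : 0 < β)
    (hβ : β < 1 / 2) (hθβ : 1 / 2 + n * θ / 2 ≤ 1 - β) {u v : ℝ → Rn n → Rn n}
    (hu : MeasurablePath (T₀ : EReal) u) (hv : MeasurablePath (T₀ : EReal) v)
    (hGu : WeakVanishing (volume.restrict (Ioo 0 T₀)) β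
      fun t => weakNorm volume θ fun x => ‖u t x‖ₑ)
    (hGv : WeakVanishing (volume.restrict (Ioo 0 T₀)) β
      fun t => weakNorm volume θ fun x => ‖v t x‖ₑ)
    (heq : ∀ᵐ t ∂(volume.restrict (Ioo 0 T₀)), ∀ᵐ x,
      u t x + opB u u t x = v t x + opB v v t x) :
    ∀ᵐ t ∂(volume.restrict (Ioo 0 T₀)), ∀ᵐ x, u t x = v t x := by
  -- Passing to Borel representatives changes the weak norms only at a null set of times and leaves
  -- the bilinear term unchanged at every point.
  obtain ⟨u', hu'm, huu'⟩ := hu.exists_measurable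
  obtain ⟨v', hv'm, hvv'⟩ := hv.exists_measurable
  have hcongr : ∀ {w w' : ℝ → Rn n → Rn n},
      (∀ᵐ t ∂(volume.restrict (Ioo 0 T₀)), ∀ᵐ x, w t x = w' t x) →
      WeakVanishing (volume.restrict (Ioo 0 T₀)) β
        (fun t => weakNorm volume θ fun x => ‖w t x‖ₑ) →
      WeakVanishing (volume.restrict (Ioo 0 T₀)) β
        (fun t => weakNorm volume θ fun x => ‖w' t x‖ₑ) := by
    intro w w' h hw
    refine hw.mono hβ0.le ?_
    filter_upwards [h] with t ht
    refine le_of_eq (weakNorm_congr ?_)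
    filter_upwards [ht] with x hx
    rw [hx]
  have h := ae_eq_of_add_opB_eq hθ0 hθ hβ0 hβ hθβ hu'm hv'm (hcongr huu' hGu) (hcongr hvv' hGv) (by
    filter_upwards [heq, huu', hvv', ae_restrict_mem measurableSet_Ioo] with t ht htu htv htT
    have hsu := ae_restrict_Ioo_of_lt huu' htT.2.le
    have hsv := ae_restrict_Ioo_of_lt hvv' htT.2.le
    filter_upwards [ht, htu, htv] with x hx hxu hxv
    rw [← hxu, ← hxv, ← opB_congr hsu hsu, ← opB_congr hsv hsv, hx])
  filter_upwards [h, huu', hvv'] with t ht htu htv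
  filter_upwards [ht, htu, htv] with x hx hxu hxv
  rw [hxu, hxv, hx]

theorem EqSpace.ae_eq {n : ℕ} {r : Exponent} {f g : Rn n → Rn n} (h : EqSpace r f g) :
    ∀ᵐ x, f x = g x := by
  cases r with
  | std p => exact h
  | bar => exact Filter.Eventually.of_forall h

/-- Cancelling the bilinear term transfers whichever equality the exponent prescribes. For ∞bar this
needs a = b at every point. -/
theorem eqSpace_of_opB_eq {n : ℕ} {r : Exponent} {F u v a b : Rn n → Rn n} (hab : a = b)
    (hu : EqSpace r F (u + a)) (hv : EqSpace r F (v + b)) : EqSpace r u v := by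
  subst hab
  cases r with
  | std p =>
    change ∀ᵐ x, u x = v x
    have hu : ∀ᵐ x, F x = u x + a x := hu
    have hv : ∀ᵐ x, F x = v x + a x := hv
    filter_upwards [hu, hv] with x hx hx'
    exact add_right_cancel (hx.symm.trans hx')
  | bar => exact fun x => add_right_cancel ((hu x).symm.trans (hv x))

theorem natCast_mul_recip_lt_one {n : ℕ} (r : Exponent) (hr : (n : ℝ≥0∞) < r.toENNReal) :
    n * r.recip < 1 := by
  unfold Exponent.recip
  rcases eq_or_ne r.toENNReal ∞ with h | h
  · simp [h]
  · have h1 : (n : ℝ) < r.toENNReal.toReal := by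
      rw [← ENNReal.toReal_natCast]
      exact (ENNReal.toReal_lt_toReal (ENNReal.natCast_ne_top n) h).2 hr
    have h0 : 0 < r.toENNReal.toReal := lt_of_le_of_lt n.cast_nonneg h1
    rw [ENNReal.toReal_inv, ← div_eq_mul_inv, div_lt_one h0]
    exact h1

theorem opB_dim_one (u v : ℝ → Rn 1 → Rn 1) (t : ℝ) : opB u v t = 0 := by
  ext x i
  simp [opB, opA, gradOseen_dim_one]

/-- The bilinear terms of two solutions with vanishing weak norms agree. -/
theorem opB_eq_opB_of_eqAE {n : ℕ} (hn : 1 ≤ n) {r : Exponent} (hr : (n : ℝ≥0∞) < r.toENNReal)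
    {β : ℝ} (hβ0 : 0 < β) (hβ : β < 1 / 2) (hrβ : 1 / 2 + n * r.recip / 2 ≤ 1 - β) {T : EReal}
    {S u v : ℝ → Rn n → Rn n}
    (hu : ∀ T' ∈ timeInterval T, MeasurablePath (T' : EReal) u ∧
      WeakVanishing (volume.restrict (Ioo 0 T')) β
        fun t => weakNorm volume r.recip fun x => ‖u t x‖ₑ)
    (hv : ∀ T' ∈ timeInterval T, MeasurablePath (T' : EReal) v ∧
      WeakVanishing (volume.restrict (Ioo 0 T')) β
        fun t => weakNorm volume r.recip fun x => ‖v t x‖ₑ)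
    (hSu : EqAE r T S (u + opB u u)) (hSv : EqAE r T S (v + opB v v)) :
    ∀ t ∈ timeInterval T, opB u u t = opB v v t := by
  intro t ht
  -- For n = 1, r > n does not give 1/r < 1/2, but there the kernel vanishes. For n ≥ 2, n/r < 1
  -- suffices.
  obtain rfl | hn2 : n = 1 ∨ 2 ≤ n := by omega
  · rw [opB_dim_one, opB_dim_one]
  have hθ0 : 0 ≤ r.recip := ENNReal.toReal_nonneg
  have hθ : r.recip < 1 / 2 := by
    have h1 := natCast_mul_recip_lt_one r hr
    have h2 : (2 : ℝ) ≤ n := by exact_mod_cast hn2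
    nlinarith
  have hsub : Ioo 0 t ⊆ timeInterval T := fun s hs =>
    ⟨hs.1, lt_trans (EReal.coe_lt_coe_iff.2 hs.2) ht.2⟩
  have heq : ∀ᵐ s ∂(volume.restrict (Ioo 0 t)), ∀ᵐ x,
      u s x + opB u u s x = v s x + opB v v s x := by
    filter_upwards [ae_restrict_of_ae_restrict_of_subset hsub hSu,
      ae_restrict_of_ae_restrict_of_subset hsub hSv] with s hs hs'
    filter_upwards [hs.ae_eq, hs'.ae_eq] with x hx hx'
    exact hx.symm.trans hx'
  have h := ae_eq_of_weakVanishing hθ0 hθ hβ0 hβ hrβ (hu t ht).1 (hv t ht).1 (hu t ht).2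
    (hv t ht).2 heq
  ext1 x
  exact opB_congr h h x

end NSLorentz

end

theorem corollary2p3 (n : ℕ) (hn : 1 ≤ n) (p : ℝ≥0∞) (hp : 1 < p)
    (r : NSLorentz.Exponent) (hr : (n : ℝ≥0∞) < r.toENNReal)
    (σ : ℝ) (hσ : -σ + n * r.recip < 1)
    (T : EReal) (hT : 0 < T)
    (f : NSLorentz.Rn n → NSLorentz.Rn n) (hf : NSLorentz.MemLorentz (.std p) ∞ f) :
    (∀ α : ℝ, 2 < α → -σ + n * r.recip < 2 / α + n * r.recip → 2 / α + n * r.recip ≤ 1 →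
      ∀ β : ℝ, 1 ≤ β →
      ∀ u v : ℝ → NSLorentz.Rn n → NSLorentz.Rn n,
        NSLorentz.MemKMinus r ∞ σ T u →
        NSLorentz.MemLMinus r ∞ (ENNReal.ofReal α) (ENNReal.ofReal β) T v →
        NSLorentz.EqAE r T (NSLorentz.heatMap f) (u + NSLorentz.opB u u) →
        NSLorentz.EqAE r T (NSLorentz.heatMap f) (v + NSLorentz.opB v v) →
        NSLorentz.EqAE r T u v) ∧
    (∀ u v : ℝ → NSLorentz.Rn n → NSLorentz.Rn n,
        NSLorentz.MemJMinus r ∞ σ T u →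
        NSLorentz.MemJMinus r ∞ σ T v →
        NSLorentz.EqE r T (NSLorentz.heatMap f) (u + NSLorentz.opB u u) →
        NSLorentz.EqE r T (NSLorentz.heatMap f) (v + NSLorentz.opB v v) →
        NSLorentz.EqE r T u v) := by
  refine ⟨fun α hα hσα hαr β hβ u v hu hv hSu hSv => ?_, fun u v hu hv hSu hSv => ?_⟩
  · have hα0 : 0 < α := by linarith
    have h2α : 2 / α = 2 * α⁻¹ := div_eq_mul_inv _ _
    have hα2 : α⁻¹ < 1 / 2 := by
      rw [one_div]
      exact inv_strictAnti₀ two_pos hα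
    -- The time exponent is β = 1/α: a ≤ 1-β reads 2/α + n/r ≤ 1, with equality allowed, and -σ/2 <
    -- β is the remaining condition on α.
    have hB := NSLorentz.opB_eq_opB_of_eqAE hn hr (inv_pos.2 hα0) hα2 (by linarith)
      (fun T' hT' => ⟨(hu T' hT').1, (hu T' hT').weakVanishing (inv_pos.2 hα0) (by linarith)⟩)
      (fun T' hT' => ⟨(hv T' hT').1, (hv T' hT').weakVanishing hα0 (by linarith)⟩) hSu hSv
    filter_upwards [hSu, hSv, ae_restrict_mem (NSLorentz.measurableSet_timeInterval T)]
      with t htu htv htT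
    exact NSLorentz.eqSpace_of_opB_eq (hB t htT) htu htv
  · have hnr := NSLorentz.natCast_mul_recip_lt_one r hr
    have hnr0 : 0 ≤ n * r.recip := mul_nonneg n.cast_nonneg ENNReal.toReal_nonneg
    -- The midpoint between max(-σ, 0)/2 and (1 - n/r)/2, so that -σ/2 < b < 1/2 and 1/2 + n/(2r) ≤
    -- 1 - b; the gap is open because -σ + n/r < 1 and n/r < 1.
    set b : ℝ := (max (-σ) 0 + (1 - n * r.recip)) / 4 with hb
    have hmax : max (-σ) 0 < 1 - n * r.recip := max_lt (by linarith) (by linarith)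
    have hσb : -σ / 2 < b := by linarith [le_max_left (-σ) 0]
    have hb0 : 0 < b := by linarith [le_max_right (-σ) 0]
    have hvan : ∀ {w : ℝ → NSLorentz.Rn n → NSLorentz.Rn n}, NSLorentz.MemJMinus r ∞ σ T w →
        ∀ T' ∈ NSLorentz.timeInterval T, NSLorentz.MeasurablePath (T' : EReal) w ∧
          NSLorentz.WeakVanishing (volume.restrict (Ioo 0 T')) b
            fun t => NSLorentz.weakNorm volume r.recip fun x => ‖w t x‖ₑ :=
      fun hw T' hT' => ⟨(hw T' hT').1, (hw T' hT').memK.weakVanishing hb0 hσb⟩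
    have hae : ∀ {w : ℝ → NSLorentz.Rn n → NSLorentz.Rn n},
        NSLorentz.EqE r T (NSLorentz.heatMap f) w → NSLorentz.EqAE r T (NSLorentz.heatMap f) w :=
      fun hw => by
        filter_upwards [ae_restrict_mem (NSLorentz.measurableSet_timeInterval T)] with t ht
        exact hw t ht
    have hB := NSLorentz.opB_eq_opB_of_eqAE hn hr hb0 (by linarith) (by linarith)
      (hvan hu) (hvan hv) (hae hSu) (hae hSv)
    exact fun t ht => NSLorentz.eqSpace_of_opB_eq (hB t ht) (hSu t ht) (hSv t ht)
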